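/- \textbf{Conventions.} A language $L$ is a (possibly infinite) collection of relation symbols and function symbols, each with a finite arity; nullary function symbols (constants) are allowed. An $L$-structure $\mathbf A$ consists of a vertex set $A$ (possibly empty), a relation $R_{\mathbf A}\subseteq A^{n}$ for every $n$-ary relation symbol $R\in L$, and a set-valued function $F_{\mathbf A}\colon A^{n}\to\mathcal P(A)$ for every $n$-ary function symbol $F\in L$. An embedding $f\colon\mathbf A\to\mathbf B$ is an injective map $f\colon A\to B$ such that $\bar x\in R_{\mathbf A}\iff f(\bar x)\in R_{\mathbf B}$ and $f[F_{\mathbf A}(\bar x)]=F_{\mathbf B}(f(\bar x))$ for all relation symbols $R$, function symbols $F$ and tuples $\bar x$ of vertices of $\mathbf A$; $\mathrm{Emb}(\mathbf A,\mathbf B)$ is the set of all embeddings. A substructure of $\mathbf A$ is given by a set $S\subseteq A$ with $F_{\mathbf A}(\bar x)\subseteq S$ for every function symbol $F$ and every tuple $\bar x$ of elements of $S$, with the induced relations and functions; it is proper if $S\ne A$. A structure $\mathbf A$ is the free amalgam of its substructures with vertex sets $S$ and $T$ (over the substructure with vertex set $S\cap T$) if $S\cup T=A$ and every tuple in a relation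 of $\mathbf A$, as well as every tuple $(x_1,\dots,x_n,y)$ with $y\in F_{\mathbf A}(x_1,\dots,x_n)$ for some function symbol $F$, has all its entries in $S$ or all its entries in $T$. A structure is irreducible if it is not the free amalgam of any two of its proper substructures. If $L$ contains a binary relation symbol $<$, an $L$-structure $\mathbf A$ is ordered if $<_{\mathbf A}$ is a (strict) linear order of $A$, and the $(L\setminus\{<\})$-reduct of $\mathbf A$ is obtained by forgetting $<_{\mathbf A}$. For a set $\mathcal F$ of $L$-structures, $\mathbf A$ is $\mathcal F$-free if there is no embedding $\mathbf F\to\mathbf A$ with $\mathbf F\in\mathcal F$. A class $\mathcal K$ of finite structures is Ramsey if for all $\mathbf A,\mathbf B\in\mathcal K$ there is $\mathbf C\in\mathcal K$ with $\mathbf C\longrightarrow(\mathbf B)^{\mathbf A}_2$, that is, for every colouring $\chi\colon\mathrm{Emb}(\mathbf A,\mathbf C)\to\{0,1\}$ there is $f\in\mathrm{Emb}(\mathbf B,\mathbf C)$ such that $\chi$ is constant on $\{f\circ e: e\in\mathrm{Emb}(\mathbf A,\mathbf B)\}$. \textbf{Theorem (Hubi\v cka--Ne\v set\v ril).} Let $L$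 be a language (possibly with both function and relation symbols) containing a binary relation symbol $<$, and let $\mathcal F$ be a set of finite $L$-structures such that every $\mathbf F\in\mathcal F$ has an irreducible $(L\setminus\{<\})$-reduct. Then the class of all finite ordered $\mathcal F$-free $L$-structures is a Ramsey class. -/

import Mathlib

universe u v w w₁ w₂ w₃

namespace SetValued

/-- A structure with vertex set `V` in the language `L`, whose functions are set-valued:
an `n`-ary function symbol sends an `n`-tuple of vertices to a set of vertices.
The language may have symbols of any arity (nullary ones included) and any number of them. -/
structure Str (L : FirstOrder.Language.{u, v}) (V : Type w) where
  /-- the interpretation of function symbols -/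
  fn : ∀ {n : ℕ}, L.Functions n → (Fin n → V) → Set V
  /-- the interpretation of relation symbols -/
  rel : ∀ {n : ℕ}, L.Relations n → (Fin n → V) → Prop

variable {L : FirstOrder.Language.{u, v}}

/-- Embeddings: injective maps that preserve relations in both directions and satisfy
`f[F_A(x)] = F_B(f(x))` for every function symbol `F`. -/
structure Emb {V : Type w₁} {W : Type w₂} (A : Str L V) (B : Str L W) where
  /-- the underlying map on vertices -/
  toFun : V → W
  injective : Function.Injective toFun
  map_fn : ∀ {n : ℕ} (F : L.Functions n) (x : Fin n → V),
    toFun '' A.fn F x = B.fn F (toFun ∘ x)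
  map_rel : ∀ {n : ℕ} (R : L.Relations n) (x : Fin n → V),
    A.rel R x ↔ B.rel R (toFun ∘ x)

/-- The composition `g ∘ f` of embeddings. -/
def Emb.comp {U : Type w₁} {V : Type w₂} {W : Type w₃} {A : Str L U} {B : Str L V} {C : Str L W}
    (g : Emb B C) (f : Emb A B) : Emb A C where
  toFun := g.toFun ∘ f.toFun
  injective := g.injective.comp f.injective
  map_fn F x := by
    rw [Set.image_comp, f.map_fn, g.map_fn]
    rfl
  map_rel R x := (f.map_rel R x).trans (g.map_rel R _)

namespace Str

variable {V : Type w}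

/-- A set of vertices is the vertex set of a substructure iff it is closed under all functions. -/
def Closed (A : Str L V) (S : Set V) : Prop :=
  ∀ {n : ℕ} (F : L.Functions n) (x : Fin n → V), (∀ i, x i ∈ S) → A.fn F x ⊆ S

/-- The structure induced on a set of vertices. It is only used for closed sets, where it is the
substructure with that vertex set. -/
def induce (A : Str L V) (S : Set V) : Str L S where
  fn F x := {y | (y : V) ∈ A.fn F (fun i => (x i : V))}
  rel R x := A.rel R (fun i => (x i : V))

/-- The inclusion of one substructure of `A` into another. -/
def inclusion (A : Str L V) {S T : Set V} (hS : A.Closed S) (h : S ⊆ T) :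
    Emb (A.induce S) (A.induce T) where
  toFun := Set.inclusion h
  injective := Set.inclusion_injective h
  map_fn F x := by
    ext ⟨y, hy⟩
    constructor
    · rintro ⟨z, hz, hzy⟩
      rw [← hzy]
      exact hz
    · intro hy'
      exact ⟨⟨y, hS F (fun i => (x i : V)) (fun i => (x i).2) hy'⟩, hy', rfl⟩
  map_rel _ _ := Iff.rfl

/-- The inclusion of a substructure of `A` into `A`. -/
def subtype (A : Str L V) {S : Set V} (hS : A.Closed S) : Emb (A.induce S) A where
  toFun := Subtype.val
  injective := Subtype.val_injective
  map_fn F x := by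
    ext y
    constructor
    · rintro ⟨z, hz, hzy⟩
      rw [← hzy]
      exact hz
    · intro hy
      exact ⟨⟨y, hS F (fun i => (x i : V)) (fun i => (x i).2) hy⟩, hy, rfl⟩
  map_rel _ _ := Iff.rfl

theorem Closed.inter {A : Str L V} {S T : Set V} (hS : A.Closed S) (hT : A.Closed T) :
    A.Closed (S ∩ T) :=
  fun F x hx _ hy => ⟨hS F x (fun i => (hx i).1) hy, hT F x (fun i => (hx i).2) hy⟩

end Str

/-- `C`, with the embeddings `β₁ : B₁ → C` and `β₂ : B₂ → C`, is the free amalgam of `B₁` and `B₂`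
over `A` with respect to `α₁ : A → B₁` and `α₂ : A → B₂`. A tuple is in a function if it consists
of an argument of the function followed by an element of the value there. -/
structure IsFreeAmalgam {U : Type w} {V₁ : Type w₁} {V₂ : Type w₂} {W : Type w₃}
    {A : Str L U} {B₁ : Str L V₁} {B₂ : Str L V₂} {C : Str L W}
    (α₁ : Emb A B₁) (α₂ : Emb A B₂) (β₁ : Emb B₁ C) (β₂ : Emb B₂ C) : Prop where
  /-- `C` is an amalgam -/
  comm : β₁.toFun ∘ α₁.toFun = β₂.toFun ∘ α₂.toFun
  /-- the amalgam is strong -/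
  strong : Set.range β₁.toFun ∩ Set.range β₂.toFun = Set.range (β₁.toFun ∘ α₁.toFun)
  /-- there are no further vertices -/
  cover : Set.range β₁.toFun ∪ Set.range β₂.toFun = Set.univ
  /-- there are no further tuples in relations -/
  rel_free : ∀ {n : ℕ} (R : L.Relations n) (x : Fin n → W), C.rel R x →
    (∀ i, x i ∈ Set.range β₁.toFun) ∨ (∀ i, x i ∈ Set.range β₂.toFun)
  /-- there are no further tuples in functions -/
  fn_free : ∀ {n : ℕ} (F : L.Functions n) (x : Fin n → W) (y : W), y ∈ C.fn F x →
    ((∀ i, x i ∈ Set.range β₁.toFun) ∧ y ∈ Set.range β₁.toFun) ∨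
      ((∀ i, x i ∈ Set.range β₂.toFun) ∧ y ∈ Set.range β₂.toFun)

/-- A structure is irreducible if it is not the free amalgam of any two of its proper
substructures (which is then necessarily over their intersection). -/
def Str.Irreducible {V : Type w} (A : Str L V) : Prop :=
  ¬ ∃ (S T : Set V) (hS : A.Closed S) (hT : A.Closed T), S ≠ Set.univ ∧ T ≠ Set.univ ∧
    IsFreeAmalgam (A.inclusion (hS.inter hT) Set.inter_subset_left)
      (A.inclusion (hS.inter hT) Set.inter_subset_right) (A.subtype hS) (A.subtype hT)

/-- The language `L ∖ {R₀}`, where `R₀` is a relation symbol of `L`. -/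
def eraseRel (L : FirstOrder.Language.{u, v}) {k : ℕ} (R₀ : L.Relations k) :
    FirstOrder.Language.{u, v} where
  Functions := L.Functions
  Relations n := {R : L.Relations n // (⟨n, R⟩ : Σ m, L.Relations m) ≠ ⟨k, R₀⟩}

/-- The `(L ∖ {R₀})`-reduct of an `L`-structure. -/
def Str.reduct {V : Type w} (A : Str L V) {k : ℕ} (R₀ : L.Relations k) :
    Str (eraseRel L R₀) V where
  fn {n} F x := A.fn (n := n) F x
  rel R x := A.rel R.1 x

/-- `A` is ordered by the binary relation symbol `lt`: its interpretation is a
(strict) linear order of the vertices. -/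
def Str.Ordered {V : Type w} (A : Str L V) (lt : L.Relations 2) : Prop :=
  IsStrictTotalOrder V (fun x y => A.rel lt ![x, y])

/-- The structural Erdős–Rado partition arrow `C ⟶ (B)^A_r`. -/
def Arrow {U : Type w₁} {V : Type w₂} {W : Type w₃} (C : Str L W) (B : Str L V) (A : Str L U)
    (r : ℕ) : Prop :=
  ∀ χ : Emb A C → Fin r, ∃ f : Emb B C, ∀ e e' : Emb A B, χ (f.comp e) = χ (f.comp e')

/-- Finite `L`-structures (possibly with no vertices). -/
structure FinStr (L : FirstOrder.Language.{u, v}) where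
  /-- the vertex set -/
  carrier : Type w
  finite : Finite carrier
  /-- the structure on the vertex set -/
  str : Str L carrier

/-- `A` is `𝓕`-free if no member of `𝓕` embeds into it. -/
def FreeOf (𝓕 : Set (FinStr.{u, v, w} L)) (A : FinStr.{u, v, w} L) : Prop :=
  ∀ F ∈ 𝓕, IsEmpty (Emb F.str A.str)

/-- The class of all finite `𝓕`-free structures that are ordered by `lt`. -/
def orderedFreeClass (lt : L.Relations 2) (𝓕 : Set (FinStr.{u, v, w} L)) :
    Set (FinStr.{u, v, w} L) :=
  {A | A.str.Ordered lt ∧ FreeOf 𝓕 A}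

/-- Ramsey classes of finite structures. -/
def IsRamsey (K : Set (FinStr.{u, v, w} L)) : Prop :=
  ∀ A ∈ K, ∀ B ∈ K, ∃ C ∈ K, Arrow C.str B.str A.str 2

end SetValued

/-! The proof runs the partite construction in two stages. The first ignores `𝓕` and finds a finite
ordered `D ⟶ (B)^A_2` (`exists_ordered_arrow`), which may well contain members of `𝓕`. The second
builds a structure `Z` over `D` whose projection embeds every irreducible substructure of the
`lt`-free reduct and maps it into one copy of `A` or of `B` in `D` (`StrOver.Good`). A copy in `Z`
of some `F ∈ 𝓕` has an irreducible reduct, so it projects to a copy of `F` inside a copy of `A` or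
`B`, which is impossible.

Both stages use `exists_arrow_of_partite`. It starts from copies of `B` glued only along the closure
of the empty set, and treats one by one the maps `α` by which `A` sits in the base. Each time the
structure is replaced by one that has, for every colouring, a copy of the old one where all copies
of `A` over `α` get one colour. Finally colours depend only on projections, and the Ramsey property
of the base finishes. The order is added at the end.

The step for one `α` is a partite lemma drawn from Hales–Jewett. In the second stage the projection
preserves relations and function values, so lines embed the part over `α` into a power of it
(`wordEmb`), and free gluing creates no irreducible substructure outside the pieces
(`exists_star_amalgam`). In the first stage the base is a bare linear order and this fails. Instead,
copies of the structure are sought that meet pairwise in a closed part of a copy of `A`; their union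
then contains each of them as a substructure (`Str.glueEmb`). Such copies come from a purely
set-theoretic partite construction performed twice, improving the intersections from `CleanAA` to
`CleanPA` to `CleanPP` (`exists_clean_ramsey_system`). -/

namespace SetValued

/-! ### Combinatorial lines acting on copies of a set. -/

section HalesJewett

variable {A : Type w₁} {W : Type w} {G : Type w₂} {κ : Type w}

open Classical in
/-- Given copies `E c` of `A` in `W`, all of which lie over the same copy `α` of `A` in `G`,
move each vertex of `W` over `α` to the corresponding vertex of the copy `E c`. -/
noncomputable def redirect (π : W → G) (α : A → G) (E : κ → A → W) : Option κ → W → W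
  | none, x => x
  | some c, x => if h : ∃ a, α a = π x then E c h.choose else x

variable {π : W → G} {α : A → G} {E : κ → A → W}

@[simp] theorem redirect_none (x : W) : redirect π α E none x = x := rfl

theorem redirect_some (hα : α.Injective) (c : κ) {x : W} {a : A} (h : π x = α a) :
    redirect π α E (some c) x = E c a := by
  have h' : ∃ a, α a = π x := ⟨a, h.symm⟩
  have : h'.choose = a := hα (h'.choose_spec.trans h)
  simp only [redirect, dif_pos h', this]

theorem map_redirect (hE : ∀ c a, π (E c a) = α a) (o : Option κ) (x : W) :
    π (redirect π α E o x) = π x := by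
  cases o with
  | none => rfl
  | some c =>
    by_cases h : ∃ a, α a = π x
    · simp only [redirect, dif_pos h, hE, h.choose_spec]
    · simp only [redirect, dif_neg h]

theorem redirect_apply (hα : α.Injective) (hE : ∀ c a, π (E c a) = α a) (o : Option κ) (c : κ)
    (a : A) : redirect π α E o (E c a) = E (o.getD c) a := by
  cases o with
  | none => rfl
  | some d => exact redirect_some hα d (hE c a)

/-- The word of a vertex `x` of `W` with respect to a combinatorial line. -/
noncomputable def lineWord {ι : Type} (π : W → G) (α : A → G) (E : κ → A → W)
    (l : Combinatorics.Line κ ι) (x : W) : ι → W :=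
  fun j => redirect π α E (l.idxFun j) x

theorem lineWord_injective {ι : Type} (l : Combinatorics.Line κ ι) :
    (lineWord π α E l).Injective := by
  intro x y h
  obtain ⟨j, hj⟩ := l.proper
  have := congrFun h j
  simpa [lineWord, hj] using this

/-- The link with Hales–Jewett: inside the copy of `W` given by a line, the copies of `A` are
exactly the points of that line. -/
theorem lineWord_apply {ι : Type} (hα : α.Injective) (hE : ∀ c a, π (E c a) = α a)
    (l : Combinatorics.Line κ ι) (c : κ) (a : A) :
    lineWord π α E l (E c a) = fun j => E (l c j) a := by
  funext j
  exact redirect_apply hα hE _ _ _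

/-- Two different lines meet either in (parts of) two copies of `A`, or they move simultaneously
and agree exactly over a part of `A`. -/
theorem lineWord_eq_iff {ι : Type} (hα : α.Injective) (hE : ∀ c a, π (E c a) = α a)
    {𝒞 : Set (Set A)} (h𝒞 : ∀ T ⊆ 𝒞, ⋂₀ T ∈ 𝒞) (hEq : ∀ c d, {a | E c a = E d a} ∈ 𝒞)
    [Nonempty κ] (l m : Combinatorics.Line κ ι) :
    ∃ S ∈ 𝒞,
      (∃ c d, ∀ x y a, π x = α a → π y = α a →
        (lineWord π α E l x = lineWord π α E m y ↔ a ∈ S ∧ x = E c a ∧ y = E d a)) ∨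
      (∀ x y a, π x = α a → π y = α a →
        (lineWord π α E l x = lineWord π α E m y ↔ x = y ∧ a ∈ S)) := by
  -- Words agree iff all letters do, so this is an intersection of equalizers of copies.
  have key : ∀ c d, {a | lineWord π α E l (E c a) = lineWord π α E m (E d a)} ∈ 𝒞 := by
    intro c d
    have := h𝒞 (Set.range fun j => {a | E (l c j) a = E (m d j) a}) (by
      rintro _ ⟨j, rfl⟩; exact hEq _ _)
    convert this using 1
    ext a
    simp only [lineWord_apply hα hE, Set.mem_ofPred_eq, funext_iff, Set.sInter_range,
      Set.mem_iInter]
  have typeI : ∀ c d, (∀ x y a, π x = α a → π y = α a →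
      lineWord π α E l x = lineWord π α E m y → x = E c a ∧ y = E d a) →
      ∃ S ∈ 𝒞, (∃ c d, ∀ x y a, π x = α a → π y = α a →
        (lineWord π α E l x = lineWord π α E m y ↔ a ∈ S ∧ x = E c a ∧ y = E d a)) := by
    intro c d h
    refine ⟨_, key c d, c, d, fun x y a hx hy => ⟨fun hxy => ?_, ?_⟩⟩
    · obtain ⟨rfl, rfl⟩ := h x y a hx hy hxy
      exact ⟨hxy, rfl, rfl⟩
    · rintro ⟨h, rfl, rfl⟩
      exact h
  -- If only `l` moves at `j`, the fixed letter of `m` pins `x` to a copy of `A`; a coordinate where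
  -- `m` moves then pins `y`.
  by_cases h1 : ∃ j, l.idxFun j = none ∧ m.idxFun j ≠ none
  · obtain ⟨j, hl, hm⟩ := h1
    obtain ⟨c, hc⟩ := Option.ne_none_iff_exists'.1 hm
    obtain ⟨k, hk⟩ := m.proper
    obtain ⟨S, hS, h⟩ := typeI c ((l.idxFun k).getD c) (by
      intro x y a hx hy hxy
      have hj := congrFun hxy j
      have hk' := congrFun hxy k
      simp only [lineWord, hl, hk, hc, redirect_none, redirect_some hα c hy] at hj hk'
      subst hj
      refine ⟨rfl, ?_⟩
      rw [← hk', redirect_apply hα hE])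
    exact ⟨S, hS, Or.inl h⟩
  by_cases h2 : ∃ j, l.idxFun j ≠ none ∧ m.idxFun j = none
  · obtain ⟨j, hl, hm⟩ := h2
    obtain ⟨c, hc⟩ := Option.ne_none_iff_exists'.1 hl
    obtain ⟨k, hk⟩ := l.proper
    obtain ⟨S, hS, h⟩ := typeI ((m.idxFun k).getD c) c (by
      intro x y a hx hy hxy
      have hj := congrFun hxy j
      have hk' := congrFun hxy k
      simp only [lineWord, hm, hk, hc, redirect_none, redirect_some hα c hx] at hj hk'
      subst hj
      refine ⟨?_, rfl⟩
      rw [hk', redirect_apply hα hE])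
    exact ⟨S, hS, Or.inl h⟩
  -- The same coordinates move, which forces `x = y`. The fixed coordinates see only `a`, so any
  -- copy `c₀` can be used to test them.
  · push Not at h1 h2
    obtain ⟨c₀⟩ := ‹Nonempty κ›
    refine ⟨_, key c₀ c₀, Or.inr fun x y a hx hy => ?_⟩
    obtain ⟨k, hk⟩ := l.proper
    have step : lineWord π α E l x = lineWord π α E m x ↔
        lineWord π α E l (E c₀ a) = lineWord π α E m (E c₀ a) := by
      simp only [funext_iff, lineWord]
      refine forall_congr' fun j => ?_
      cases hj : l.idxFun j with
      | none => simp [h1 j hj]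
      | some c =>
        cases hj' : m.idxFun j with
        | none => exact absurd hj' (h2 j (by simp [hj]))
        | some d => simp only [redirect_some hα _ hx, redirect_some hα _ (hE c₀ a)]
    constructor
    · intro hxy
      have hk' := congrFun hxy k
      simp only [lineWord, hk, h1 k hk, redirect_none] at hk'
      subst hk'
      exact ⟨rfl, step.1 hxy⟩
    · rintro ⟨rfl, h⟩
      exact step.2 h

/-- A system of copies of `W`, amalgamated over the part of `W` over `α`, such that each colouring
of the copies of `A` has a copy of `W` in which all the copies `E c` of `A` get the same colour. -/
theorem exists_line_amalgam [Finite W] [Finite κ] [Nonempty κ] (hα : α.Injective)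
    (hE : ∀ c a, π (E c a) = α a) {𝒞 : Set (Set A)} (h𝒞 : ∀ T ⊆ 𝒞, ⋂₀ T ∈ 𝒞)
    (hEq : ∀ c d, {a | E c a = E d a} ∈ 𝒞) :
    ∃ (W' Λ : Type w) (_ : Finite W') (_ : Finite Λ) (π' : W' → G) (f : Λ → W → W'),
      (∀ l x, π' (f l x) = π x) ∧ (∀ l, (f l).Injective) ∧
      (∀ χ : (A → W') → Fin 2, ∃ l, ∀ c d, χ (f l ∘ E c) = χ (f l ∘ E d)) ∧
      ∀ l m, l ≠ m → ∃ S ∈ 𝒞,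
        (∃ c d, ∀ x y, f l x = f m y ↔ ∃ a ∈ S, x = E c a ∧ y = E d a) ∨
        (∀ x y, f l x = f m y ↔ x = y ∧ ∃ a ∈ S, π x = α a) := by
  classical
  obtain ⟨ι, _, hι⟩ := Combinatorics.Line.exists_mono_in_high_dimension κ (Fin 2)
  obtain ⟨l₀, -⟩ := hι fun _ => 0
  have ⟨j₀, _⟩ := l₀.proper
  have : Finite (Combinatorics.Line κ ι) :=
    Finite.of_injective (fun l => l.idxFun) fun l m h => Combinatorics.Line.ext h
  -- The mark separates the copies of `W` outside the part over `α`, where the words alone might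
  -- coincide.
  let mark : Combinatorics.Line κ ι → W → Option (Combinatorics.Line κ ι) := fun l x =>
    if ∃ a, π x = α a then none else some l
  refine ⟨(ι → W) × Option (Combinatorics.Line κ ι), Combinatorics.Line κ ι, inferInstance,
    inferInstance, fun p => π (p.1 j₀), fun l x => (lineWord π α E l x, mark l x),
    fun l x => map_redirect hE _ _, fun l x y h => lineWord_injective l (Prod.ext_iff.1 h).1,
    fun χ => ?_, fun l m hlm => ?_⟩
  · obtain ⟨l, c, hl⟩ := hι fun u => χ fun a => (fun j => E (u j) a, none)
    have : ∀ d, χ ((fun x => (lineWord π α E l x, mark l x)) ∘ E d) = c := by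
      intro d
      rw [← hl d]
      congr 1
      funext a
      have : ∃ b, π (E d a) = α b := ⟨a, hE d a⟩
      simp only [Function.comp, lineWord_apply hα hE, mark, if_pos this]
    exact ⟨l, fun d d' => (this d).trans (this d').symm⟩
  · have proj : ∀ x y, (lineWord π α E l x, mark l x) = (lineWord π α E m y, mark m y) →
        ∃ a, π x = α a ∧ π y = α a := by
      intro x y h
      obtain ⟨h, h'⟩ := Prod.ext_iff.1 h
      simp only [mark] at h'
      have hxy : π x = π y := by
        have := congrArg π (congrFun h j₀)
        simpa only [lineWord, map_redirect hE] using this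
      by_cases hx : ∃ a, π x = α a
      · obtain ⟨a, ha⟩ := hx
        exact ⟨a, ha, hxy ▸ ha⟩
      · rw [if_neg hx, if_neg (by rwa [← hxy]), Option.some_inj] at h'
        exact absurd h' hlm
    have marks : ∀ x y a, π x = α a → π y = α a → mark l x = mark m y := by
      intro x y a hx hy
      simp only [mark, if_pos (⟨a, hx⟩ : ∃ a, π x = α a), if_pos (⟨a, hy⟩ : ∃ a, π y = α a)]
    obtain ⟨S, hS, ⟨c, d, h⟩ | h⟩ := lineWord_eq_iff hα hE h𝒞 hEq l m
    · refine ⟨S, hS, Or.inl ⟨c, d, fun x y => ⟨fun hxy => ?_, ?_⟩⟩⟩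
      · obtain ⟨a, hx, hy⟩ := proj x y hxy
        exact ⟨a, (h x y a hx hy).1 (Prod.ext_iff.1 hxy).1⟩
      · rintro ⟨a, ha, rfl, rfl⟩
        exact Prod.ext ((h _ _ a (hE c a) (hE d a)).2 ⟨ha, rfl, rfl⟩)
          (marks _ _ a (hE c a) (hE d a))
    · refine ⟨S, hS, Or.inr fun x y => ⟨fun hxy => ?_, ?_⟩⟩
      · obtain ⟨a, hx, hy⟩ := proj x y hxy
        have := (h x y a hx hy).1 (Prod.ext_iff.1 hxy).1
        exact ⟨this.1, a, this.2, hx⟩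
      · rintro ⟨rfl, a, ha, hx⟩
        exact Prod.ext ((h _ _ a hx hx).2 ⟨rfl, ha⟩) (marks _ _ a hx hx)

end HalesJewett

/-! ### Set-theoretic partite construction with controlled intersections. -/

section CopySystems

variable {A P σ : Type w} {𝒞 : Set (Set A)} {ε : σ → A → P}

theorem univ_mem_of_sInter_mem (h𝒞 : ∀ T ⊆ 𝒞, ⋂₀ T ∈ 𝒞) : Set.univ ∈ 𝒞 := by
  simpa using h𝒞 ∅ (Set.empty_subset _)

theorem inter_mem_of_sInter_mem (h𝒞 : ∀ T ⊆ 𝒞, ⋂₀ T ∈ 𝒞) {S T : Set A} (hS : S ∈ 𝒞)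
    (hT : T ∈ 𝒞) : S ∩ T ∈ 𝒞 := by
  simpa using h𝒞 {S, T} (by rintro _ (rfl | rfl) <;> assumption)

/-- The copies `g i ∘ ε s` of `A` intersect transversally in sets of `𝒞`. -/
def CleanAA (𝒞 : Set (Set A)) (ε : σ → A → P) {I : Type w₁} {W : Type w₂} (g : I → P → W) : Prop :=
  ∀ i j s t, (∀ a b, g i (ε s a) = g j (ε t b) → a = b) ∧ {a | g i (ε s a) = g j (ε t a)} ∈ 𝒞

/-- Each copy of `P` meets each copy of `A` in a part of one of its own copies of `A`. -/
def CleanPA (𝒞 : Set (Set A)) (ε : σ → A → P) {I : Type w₁} {W : Type w₂} (g : I → P → W) : Prop :=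
  ∀ i j t, ∃ s, ∃ S ∈ 𝒞, ∀ x a, g i x = g j (ε t a) ↔ a ∈ S ∧ x = ε s a

/-- Any two copies of `P` meet in a part of a common copy of `A`. -/
def CleanPP (𝒞 : Set (Set A)) (ε : σ → A → P) {I : Type w₁} {W : Type w₂} (g : I → P → W) : Prop :=
  ∀ i j, i ≠ j → ∃ s t, ∃ S ∈ 𝒞, ∀ x y, g i x = g j y ↔ ∃ a ∈ S, x = ε s a ∧ y = ε t a

theorem CleanPA.cleanAA (h𝒞 : ∀ T ⊆ 𝒞, ⋂₀ T ∈ 𝒞) (hε : ∀ s t a b, ε s a = ε t b → a = b)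
    (hEq : ∀ s t, {a | ε s a = ε t a} ∈ 𝒞) {I : Type w₁} {W : Type w₂} {g : I → P → W}
    (h : CleanPA 𝒞 ε g) : CleanAA 𝒞 ε g := by
  intro i j s t
  obtain ⟨s', S, hS, h⟩ := h i j t
  refine ⟨fun a b hab => hε _ _ _ _ ((h _ _).1 hab).2, ?_⟩
  convert inter_mem_of_sInter_mem h𝒞 hS (hEq s s') using 1
  ext a
  exact h _ _

/-- A partite system over the copies `γ j` of `P`. -/
structure PartiteSystem (𝒞 : Set (Set A)) (ε : σ → A → P) {J : Type w₁} {G : Type w₂}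
    (γ : J → P → G) where
  /-- the vertices -/
  W : Type w
  /-- the index set of the copies of `P` -/
  I : Type w
  finite_W : Finite W
  finite_I : Finite I
  /-- the copies of `P` -/
  copy : I → P → W
  /-- the projection to the base -/
  proj : W → G
  proj_copy : ∀ i, ∃ j, ∀ x, proj (copy i x) = γ j x
  injective : ∀ i, (copy i).Injective
  cleanPA : CleanPA 𝒞 ε copy
  cleanPP : CleanPA 𝒞 ε γ → CleanPP 𝒞 ε copy

namespace PartiteSystem

variable {J : Type w₁} {G : Type w₂} {γ : J → P → G}

/-- `Y` has a copy of `X` in which the colour of a copy of `A` over one of the `α ∈ l` depends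
only on `α`. -/
def HomogeneousOver (X Y : PartiteSystem 𝒞 ε γ) (l : Set (A → G)) : Prop :=
  ∀ χ : (A → Y.W) → Fin 2, ∃ f : X.W → Y.W, (∀ x, Y.proj (f x) = X.proj x) ∧
    (∀ i, ∃ i', ∀ x, f (X.copy i x) = Y.copy i' x) ∧
    ∀ α ∈ l, ∀ i j s t, (∀ a, X.proj (X.copy i (ε s a)) = α a) →
      (∀ a, X.proj (X.copy j (ε t a)) = α a) →
      χ (fun a => f (X.copy i (ε s a))) = χ (fun a => f (X.copy j (ε t a)))

/-- Two copies of `X` on different lines meet either in parts of two copies of `A`, where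
`X.cleanPA` suffices, or in all vertices over a part `S` of `α`. In the second case the base must
help: `CleanAA` of `γ` yields `CleanPA`, and `CleanPA` of `γ` yields `CleanPP`. Hence the field
`cleanPP` is conditional. -/
theorem exists_step (h𝒞 : ∀ T ⊆ 𝒞, ⋂₀ T ∈ 𝒞) (hε : ∀ s t a b, ε s a = ε t b → a = b)
    (hEq : ∀ s t, {a | ε s a = ε t a} ∈ 𝒞) [Finite σ] (hγ : CleanAA 𝒞 ε γ)
    (X : PartiteSystem 𝒞 ε γ) (j₀ : J) (s₀ : σ) :
    ∃ Y : PartiteSystem 𝒞 ε γ, X.HomogeneousOver Y {fun a => γ j₀ (ε s₀ a)} := by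
  classical
  have := X.finite_W
  have := X.finite_I
  let κ := {p : X.I × σ // ∀ a, X.proj (X.copy p.1 (ε p.2 a)) = γ j₀ (ε s₀ a)}
  by_cases hκ : Nonempty κ
  swap
  · refine ⟨X, fun χ => ⟨id, fun _ => rfl, fun i => ⟨i, fun _ => rfl⟩, ?_⟩⟩
    rintro _ rfl i _ s _ hi _
    exact absurd ⟨⟨(i, s), hi⟩⟩ hκ
  have hAA := X.cleanPA.cleanAA h𝒞 hε hEq
  obtain ⟨W', Λ, _, _, π', f, hπ', hf, hram, hint⟩ := exists_line_amalgam (π := X.proj)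
    (α := fun a => γ j₀ (ε s₀ a)) (E := fun (c : κ) a => X.copy c.1.1 (ε c.1.2 a))
    (fun a b h => (hγ j₀ j₀ s₀ s₀).1 a b h) (fun c => c.2) h𝒞
    (fun c d => (hAA c.1.1 d.1.1 c.1.2 d.1.2).2)
  refine ⟨⟨W', Λ × X.I, inferInstance, inferInstance, fun p x => f p.1 (X.copy p.2 x), π', ?_, ?_,
    ?_, ?_⟩, ?_⟩
  · rintro ⟨l, i⟩
    obtain ⟨j, hj⟩ := X.proj_copy i
    exact ⟨j, fun x => (hπ' _ _).trans (hj x)⟩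
  · rintro ⟨l, i⟩
    exact (hf l).comp (X.injective i)
  · rintro ⟨l, i⟩ ⟨m, j⟩ t
    by_cases hlm : l = m
    · subst hlm
      obtain ⟨s, S, hS, h⟩ := X.cleanPA i j t
      exact ⟨s, S, hS, fun x a => (hf l).eq_iff.trans (h x a)⟩
    · obtain ⟨S, hS, ⟨⟨⟨k, s⟩, _⟩, ⟨⟨k', s'⟩, _⟩, h⟩ | h⟩ := hint l m hlm
      · obtain ⟨s₁, S₁, hS₁, h₁⟩ := X.cleanPA i k s
        refine ⟨s₁, S ∩ (S₁ ∩ _), inter_mem_of_sInter_mem h𝒞 hS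
          (inter_mem_of_sInter_mem h𝒞 hS₁ (hAA j k' t s').2), fun x a => (h _ _).trans ?_⟩
        constructor
        · rintro ⟨b, hb, hx, ha⟩
          obtain rfl := (hAA _ _ _ _).1 _ _ ha
          have := (h₁ _ _).1 hx
          exact ⟨⟨hb, this.1, ha⟩, this.2⟩
        · rintro ⟨⟨hb, ha, hx⟩, rfl⟩
          exact ⟨a, hb, (h₁ _ _).2 ⟨ha, rfl⟩, hx⟩
      · obtain ⟨s₁, S₁, hS₁, h₁⟩ := X.cleanPA i j t
        obtain ⟨k, hk⟩ := X.proj_copy j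
        refine ⟨s₁, S ∩ (S₁ ∩ _), inter_mem_of_sInter_mem h𝒞 hS
          (inter_mem_of_sInter_mem h𝒞 hS₁ (hγ k j₀ t s₀).2), fun x a => (h _ _).trans ?_⟩
        constructor
        · rintro ⟨hx, b, hb, ha⟩
          rw [hx, hk] at ha
          obtain rfl := (hγ _ _ _ _).1 _ _ ha
          have := (h₁ _ _).1 hx
          exact ⟨⟨hb, this.1, ha⟩, this.2⟩
        · rintro ⟨⟨hb, ha, hx⟩, rfl⟩
          have := (h₁ _ _).2 ⟨ha, rfl⟩
          refine ⟨this, a, hb, ?_⟩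
          rw [this, hk]
          exact hx
  · intro hPA
    rintro ⟨l, i⟩ ⟨m, j⟩ hij
    have hPP := X.cleanPP hPA
    by_cases hlm : l = m
    · subst hlm
      obtain ⟨s, t, S, hS, h⟩ := hPP i j (fun h => hij (by rw [h]))
      exact ⟨s, t, S, hS, fun x y => (hf l).eq_iff.trans (h x y)⟩
    · obtain ⟨S, hS, ⟨⟨⟨k, s⟩, _⟩, ⟨⟨k', s'⟩, _⟩, h⟩ | h⟩ := hint l m hlm
      · obtain ⟨s₁, S₁, hS₁, h₁⟩ := X.cleanPA i k s
        obtain ⟨s₂, S₂, hS₂, h₂⟩ := X.cleanPA j k' s'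
        refine ⟨s₁, s₂, S ∩ (S₁ ∩ S₂), inter_mem_of_sInter_mem h𝒞 hS
          (inter_mem_of_sInter_mem h𝒞 hS₁ hS₂), fun x y => (h _ _).trans ?_⟩
        constructor
        · rintro ⟨a, ha, hx, hy⟩
          have hx := (h₁ _ _).1 hx
          have hy := (h₂ _ _).1 hy
          exact ⟨a, ⟨ha, hx.1, hy.1⟩, hx.2, hy.2⟩
        · rintro ⟨a, ⟨ha, hx, hy⟩, rfl, rfl⟩
          exact ⟨a, ha, (h₁ _ _).2 ⟨hx, rfl⟩, (h₂ _ _).2 ⟨hy, rfl⟩⟩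
      · obtain ⟨k, hk⟩ := X.proj_copy i
        -- One copy of `P` placed on two lines shares all its vertices over `S`. That these form
        -- part of a copy of `A` is where `hPA` enters directly.
        by_cases hij' : i = j
        · subst hij'
          obtain ⟨s₁, S₁, hS₁, h₁⟩ := hPA k j₀ s₀
          refine ⟨s₁, s₁, S ∩ S₁, inter_mem_of_sInter_mem h𝒞 hS hS₁,
            fun x y => (h _ _).trans ?_⟩
          constructor
          · rintro ⟨hx, a, ha, hxa⟩
            rw [hk] at hxa
            obtain rfl := X.injective i hx
            have := (h₁ _ _).1 hxa
            exact ⟨a, ⟨ha, this.1⟩, this.2, this.2⟩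
          · rintro ⟨a, ⟨ha, ha'⟩, rfl, rfl⟩
            refine ⟨rfl, a, ha, ?_⟩
            rw [hk]
            exact (h₁ _ _).2 ⟨ha', rfl⟩
        · obtain ⟨s, t, S₁, hS₁, h₁⟩ := hPP i j hij'
          refine ⟨s, t, S ∩ (S₁ ∩ _), inter_mem_of_sInter_mem h𝒞 hS
            (inter_mem_of_sInter_mem h𝒞 hS₁ (hγ k j₀ s s₀).2), fun x y => (h _ _).trans ?_⟩
          constructor
          · rintro ⟨hx, a, ha, hxa⟩
            obtain ⟨b, hb, rfl, rfl⟩ := (h₁ _ _).1 hx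
            rw [hk] at hxa
            obtain rfl := (hγ _ _ _ _).1 _ _ hxa
            exact ⟨b, ⟨ha, hb, hxa⟩, rfl, rfl⟩
          · rintro ⟨a, ⟨ha, ha₁, hxa⟩, rfl, rfl⟩
            refine ⟨(h₁ _ _).2 ⟨a, ha₁, rfl, rfl⟩, a, ha, ?_⟩
            rw [hk]
            exact hxa
  · intro χ
    obtain ⟨l, hl⟩ := hram χ
    refine ⟨f l, hπ' l, fun i => ⟨(l, i), fun _ => rfl⟩, ?_⟩
    rintro _ rfl i j s t hi hj
    exact hl ⟨(i, s), hi⟩ ⟨(j, t), hj⟩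

theorem exists_homogeneousOver (h𝒞 : ∀ T ⊆ 𝒞, ⋂₀ T ∈ 𝒞)
    (hε : ∀ s t a b, ε s a = ε t b → a = b)
    (hEq : ∀ s t, {a | ε s a = ε t a} ∈ 𝒞) [Finite σ] (hγ : CleanAA 𝒞 ε γ)
    (l : List (J × σ)) (X : PartiteSystem 𝒞 ε γ) :
    ∃ Y : PartiteSystem 𝒞 ε γ,
      X.HomogeneousOver Y {α | ∃ p ∈ l, α = fun a => γ p.1 (ε p.2 a)} := by
  induction l generalizing X with
  | nil =>
    refine ⟨X, fun χ => ⟨id, fun _ => rfl, fun i => ⟨i, fun _ => rfl⟩, ?_⟩⟩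
    rintro α ⟨p, hp, -⟩
    simp at hp
  | cons p l ih =>
    obtain ⟨Y, hY⟩ := exists_step h𝒞 hε hEq hγ X p.1 p.2
    obtain ⟨Z, hZ⟩ := ih Y
    refine ⟨Z, fun χ => ?_⟩
    obtain ⟨g, hg, hgc, hgl⟩ := hZ χ
    obtain ⟨f, hf, hfc, hfl⟩ := hY fun e => χ fun a => g (e a)
    refine ⟨g ∘ f, fun x => (hg _).trans (hf x), fun i => ?_, ?_⟩
    · obtain ⟨i', hi'⟩ := hfc i
      obtain ⟨i'', hi''⟩ := hgc i'
      exact ⟨i'', fun x => by simp only [Function.comp, hi', hi'']⟩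
    · rintro α ⟨q, hq, hα⟩ i j s t hi hj
      rcases List.mem_cons.1 hq with rfl | hq
      · exact hfl α hα i j s t hi hj
      · obtain ⟨i', hi'⟩ := hfc i
        obtain ⟨j', hj'⟩ := hfc j
        have := hgl α ⟨q, hq, hα⟩ i' j' s t (fun a => by rw [← hi', hf, hi])
          (fun a => by rw [← hj', hf, hj])
        simpa only [Function.comp, hi', hj'] using this

open Classical in
/-- The disjoint copies of `P`, glued along the part `K` common to all copies of `A`. -/
theorem exists_init (h𝒞 : ∀ T ⊆ 𝒞, ⋂₀ T ∈ 𝒞) (hε : ∀ s t a b, ε s a = ε t b → a = b)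
    (hEq : ∀ s t, {a | ε s a = ε t a} ∈ 𝒞) [Finite P] {J : Type w} [Finite J] {γ : J → P → G}
    (hγ : CleanAA 𝒞 ε γ) (j₀ : J) (s₀ : σ) :
    ∃ X : PartiteSystem 𝒞 ε γ, ∀ j, ∃ i, ∀ x, X.proj (X.copy i x) = γ j x := by
  -- `𝒞` may omit the empty set, so disjoint copies need not be clean. The least member of `𝒞` is
  -- the smallest overlap allowed.
  let S₀ : Set A := ⋂₀ 𝒞
  have hS₀ : S₀ ∈ 𝒞 := h𝒞 _ subset_rfl
  let K : Set P := ε s₀ '' S₀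
  have hK : ∀ t a, ε t a ∈ K ↔ a ∈ S₀ := by
    intro t a
    constructor
    · rintro ⟨b, hb, h⟩
      rwa [← hε _ _ _ _ h]
    · intro ha
      exact ⟨a, ha, ha _ (hEq s₀ t)⟩
  have hKγ : ∀ x ∈ K, ∀ j, γ j₀ x = γ j x := by
    rintro _ ⟨a, ha, rfl⟩ j
    exact ha _ (hγ j₀ j s₀ s₀).2
  let copy : J → P → P × Option J := fun j x => (x, if x ∈ K then none else some j)
  have hcopy : ∀ i j, i ≠ j → ∀ x y, copy i x = copy j y ↔ x = y ∧ x ∈ K := by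
    intro i j hij x y
    constructor
    · intro h
      obtain ⟨rfl, h⟩ := Prod.ext_iff.1 h
      refine ⟨rfl, ?_⟩
      by_contra hx
      have hx' : x ∉ K := hx
      simp only [copy, if_neg hx', Option.some_inj] at h
      exact hij h
    · rintro ⟨rfl, hx⟩
      simp only [copy, if_pos hx]
  refine ⟨⟨P × Option J, J, inferInstance, inferInstance, copy,
    fun p => p.2.elim (γ j₀ p.1) fun j => γ j p.1, fun j => ⟨j, fun x => ?_⟩,
    fun i x y h => (Prod.ext_iff.1 h).1, fun i j t => ?_, fun _ i j hij => ?_⟩,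
    fun j => ⟨j, fun x => ?_⟩⟩
  · by_cases hx : x ∈ K
    · simp only [copy, if_pos hx, Option.elim_none, hKγ x hx j]
    · simp only [copy, if_neg hx, Option.elim_some]
  · by_cases hij : i = j
    · subst hij
      refine ⟨t, Set.univ, univ_mem_of_sInter_mem h𝒞, fun x a => ⟨fun h => ?_, ?_⟩⟩
      · exact ⟨trivial, (Prod.ext_iff.1 h).1⟩
      · rintro ⟨-, rfl⟩
        rfl
    · refine ⟨t, S₀, hS₀, fun x a => (hcopy i j hij _ _).trans ⟨?_, ?_⟩⟩
      · rintro ⟨rfl, h⟩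
        exact ⟨(hK _ _).1 h, rfl⟩
      · rintro ⟨h, rfl⟩
        exact ⟨rfl, (hK _ _).2 h⟩
  · refine ⟨s₀, s₀, S₀, hS₀, fun x y => (hcopy i j hij _ _).trans ⟨?_, ?_⟩⟩
    · rintro ⟨rfl, a, ha, rfl⟩
      exact ⟨a, ha, rfl, rfl⟩
    · rintro ⟨a, ha, rfl, rfl⟩
      exact ⟨rfl, a, ha, rfl⟩
  · by_cases hx : x ∈ K
    · simp only [copy, if_pos hx, Option.elim_none, hKγ x hx j]
    · simp only [copy, if_neg hx, Option.elim_some]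

/-- The partite construction over a Ramsey system of copies of `P`. -/
theorem exists_ramsey (h𝒞 : ∀ T ⊆ 𝒞, ⋂₀ T ∈ 𝒞) (hε : ∀ s t a b, ε s a = ε t b → a = b)
    (hEq : ∀ s t, {a | ε s a = ε t a} ∈ 𝒞) [Finite P] [Finite σ] (s₀ : σ) {J : Type w} [Finite J]
    {γ : J → P → G} (hγ : CleanAA 𝒞 ε γ)
    (hram : ∀ χ : (A → G) → Fin 2, ∃ j, ∀ s t,
      χ (fun a => γ j (ε s a)) = χ (fun a => γ j (ε t a))) :
    ∃ Y : PartiteSystem 𝒞 ε γ, ∀ χ : (A → Y.W) → Fin 2, ∃ i, ∀ s t,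
      χ (fun a => Y.copy i (ε s a)) = χ (fun a => Y.copy i (ε t a)) := by
  classical
  obtain ⟨j₀, -⟩ := hram fun _ => 0
  obtain ⟨X, hX⟩ := exists_init h𝒞 hε hEq hγ j₀ s₀
  have : Fintype (J × σ) := Fintype.ofFinite _
  obtain ⟨Y, hY⟩ := exists_homogeneousOver h𝒞 hε hEq hγ Finset.univ.toList X
  refine ⟨Y, fun χ => ?_⟩
  obtain ⟨f, hf, hfc, hfl⟩ := hY χ
  -- By `hfl` the chosen representative does not matter for the maps `γ j ∘ ε s`; the value `0` is
  -- never used for them.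
  let c : (A → G) → Fin 2 := fun α =>
    if h : ∃ p : X.I × σ, ∀ a, X.proj (X.copy p.1 (ε p.2 a)) = α a then
      χ fun a => f (X.copy h.choose.1 (ε h.choose.2 a)) else 0
  have hc : ∀ j s i, (∀ x, X.proj (X.copy i x) = γ j x) →
      c (fun a => γ j (ε s a)) = χ fun a => f (X.copy i (ε s a)) := by
    intro j s i hi
    have h : ∃ p : X.I × σ, ∀ a, X.proj (X.copy p.1 (ε p.2 a)) = γ j (ε s a) :=
      ⟨(i, s), fun a => hi _⟩
    simp only [c, dif_pos h]
    exact hfl _ ⟨(j, s), by simp, rfl⟩ _ _ _ _ h.choose_spec (fun a => hi _)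
  obtain ⟨j, hj⟩ := hram c
  obtain ⟨i, hi⟩ := hX j
  obtain ⟨i', hi'⟩ := hfc i
  refine ⟨i', fun s t => ?_⟩
  have := hj s t
  rw [hc j s i hi, hc j t i hi] at this
  simpa only [hi'] using this

end PartiteSystem

/-- For each finite set `P` with transversal copies `ε s` of `A` over `α` there is a Ramsey system
of copies of `P`, any two of which meet in a part of a common copy of `A`. -/
theorem exists_clean_ramsey_system (h𝒞 : ∀ T ⊆ 𝒞, ⋂₀ T ∈ 𝒞)
    (hEq : ∀ s t, {a | ε s a = ε t a} ∈ 𝒞) [Finite P] [Finite σ] [Nonempty σ] {G : Type w₂}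
    {π : P → G} {α : A → G} (hα : α.Injective) (hεα : ∀ s a, π (ε s a) = α a) :
    ∃ (W I : Type w) (_ : Finite W) (_ : Finite I) (τ : W → G) (g : I → P → W),
      (∀ i x, τ (g i x) = π x) ∧ (∀ i, (g i).Injective) ∧
      (∀ χ : (A → W) → Fin 2, ∃ i, ∀ s t,
        χ (fun a => g i (ε s a)) = χ (fun a => g i (ε t a))) ∧
      CleanPP 𝒞 ε g := by
  obtain ⟨s₀⟩ := ‹Nonempty σ›
  have hε : ∀ s t a b, ε s a = ε t b → a = b := by
    intro s t a b h
    apply hα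
    rw [← hεα s, ← hεα t, h]
  obtain ⟨W', Λ, _, _, π', f, hπ', hf, hram, hint⟩ := exists_line_amalgam hα hεα h𝒞 hEq
  have hAA : CleanAA 𝒞 ε f := by
    intro l m s t
    refine ⟨fun a b h => hα ?_, ?_⟩
    · rw [← hεα s, ← hεα t, ← hπ' l, ← hπ' m, h]
    · by_cases hlm : l = m
      · subst hlm
        simpa only [(hf l).eq_iff] using hEq s t
      · obtain ⟨S, hS, ⟨c, d, h⟩ | h⟩ := hint l m hlm
        · convert inter_mem_of_sInter_mem h𝒞 hS
            (inter_mem_of_sInter_mem h𝒞 (hEq s c) (hEq t d)) using 1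
          ext a
          refine (h _ _).trans ⟨?_, ?_⟩
          · rintro ⟨b, hb, h₁, h₂⟩
            obtain rfl := hε _ _ _ _ h₁
            exact ⟨hb, h₁, h₂⟩
          · rintro ⟨hb, h₁, h₂⟩
            exact ⟨a, hb, h₁, h₂⟩
        · convert inter_mem_of_sInter_mem h𝒞 hS (hEq s t) using 1
          ext a
          refine (h _ _).trans ⟨?_, ?_⟩
          · rintro ⟨h₁, b, hb, h₂⟩
            rw [hεα] at h₂
            obtain rfl := hα h₂
            exact ⟨hb, h₁⟩
          · rintro ⟨hb, h₁⟩
            exact ⟨h₁, a, hb, hεα _ _⟩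
  -- The line system is only `CleanAA`, so `Y` is only `CleanPA`. With `Y` as the base, the second
  -- pass unlocks `cleanPP`.
  obtain ⟨Y, hY⟩ := PartiteSystem.exists_ramsey h𝒞 hε hEq s₀ hAA hram
  have := Y.finite_I
  obtain ⟨Z, hZ⟩ := PartiteSystem.exists_ramsey h𝒞 hε hEq s₀
    (Y.cleanPA.cleanAA h𝒞 hε hEq) hY
  refine ⟨Z.W, Z.I, Z.finite_W, Z.finite_I, fun x => π' (Y.proj (Z.proj x)), Z.copy, fun i x => ?_,
    Z.injective, hZ, Z.cleanPP Y.cleanPA⟩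
  obtain ⟨j, hj⟩ := Z.proj_copy i
  obtain ⟨l, hl⟩ := Y.proj_copy j
  simp only [hj, hl, hπ']

end CopySystems

/-! ### Gluing structures, and the partite lemma over a bare set. -/

section Structures

variable {L : FirstOrder.Language.{u, v}}

theorem Emb.ext {V : Type w₁} {W : Type w₂} {A : Str L V} {B : Str L W} {f g : Emb A B}
    (h : ∀ x, f.toFun x = g.toFun x) : f = g := by
  cases f
  cases g
  congr
  exact funext h

instance {V : Type w₁} {W : Type w₂} [Finite V] [Finite W] (A : Str L V) (B : Str L W) :
    Finite (Emb A B) :=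
  Finite.of_injective (fun f => f.toFun) fun _ _ h => Emb.ext (congrFun h)

/-- The identity embedding. -/
def Emb.id {V : Type w₁} (A : Str L V) : Emb A A where
  toFun := _root_.id
  injective := Function.injective_id
  map_fn _ _ := Set.image_id _
  map_rel _ _ := Iff.rfl

namespace Str

variable {V : Type w₁} {W : Type w₂} {A : Str L V} {B : Str L W}

theorem closed_univ : A.Closed Set.univ := fun _ _ _ => Set.subset_univ _

theorem closed_sInter {T : Set (Set V)} (hT : ∀ S ∈ T, A.Closed S) : A.Closed (⋂₀ T) :=
  fun F x hx _ hy S hS => hT S hS F x (fun i => hx i S hS) hy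

theorem Closed.preimage (f : Emb A B) {S : Set W} (hS : B.Closed S) :
    A.Closed (f.toFun ⁻¹' S) := by
  intro n F x hx y hy
  refine hS F (f.toFun ∘ x) hx ?_
  rw [← f.map_fn]
  exact ⟨y, hy, rfl⟩

theorem Closed.image (f : Emb A B) {S : Set V} (hS : A.Closed S) : B.Closed (f.toFun '' S) := by
  intro n F x hx y hy
  choose u hu hux using hx
  obtain rfl : f.toFun ∘ u = x := funext hux
  rw [← f.map_fn] at hy
  obtain ⟨z, hz, rfl⟩ := hy
  exact ⟨z, hS F u hu hz, rfl⟩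

theorem closed_range (f : Emb A B) : B.Closed (Set.range f.toFun) := by
  rw [← Set.image_univ]
  exact closed_univ.image f

/-- The closure of a set of vertices under the functions of `A`. -/
def cl (A : Str L V) (S : Set V) : Set V := ⋂₀ {T | A.Closed T ∧ S ⊆ T}

theorem closed_cl (S : Set V) : A.Closed (A.cl S) := closed_sInter fun _ h => h.1

theorem subset_cl (S : Set V) : S ⊆ A.cl S := fun _ hx _ hT => hT.2 hx

theorem cl_subset {S T : Set V} (hT : A.Closed T) (h : S ⊆ T) : A.cl S ⊆ T :=
  fun _ hx => hx T ⟨hT, h⟩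

theorem mem_cl_empty_iff (f : Emb A B) (x : V) : f.toFun x ∈ B.cl ∅ ↔ x ∈ A.cl ∅ := by
  constructor
  · intro h
    have := cl_subset (Closed.image f (closed_cl (A := A) ∅)) (Set.empty_subset _) h
    obtain ⟨y, hy, hyx⟩ := this
    rwa [← f.injective hyx]
  · intro h
    exact cl_subset (Closed.preimage f (closed_cl (A := B) ∅)) (Set.empty_subset _) h

theorem cl_empty_eq_image (f : Emb A B) : B.cl ∅ = f.toFun '' A.cl ∅ := by
  apply Set.Subset.antisymm
  · exact cl_subset (Closed.image f (closed_cl (A := A) ∅)) (Set.empty_subset _)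
  · rintro _ ⟨x, hx, rfl⟩
    exact (mem_cl_empty_iff f x).2 hx

/-- The set on which two embeddings agree is closed, if the embeddings can only take the same
values at the same places. -/
theorem closed_equalizer (f g : Emb A B) (h : ∀ x y, f.toFun x = g.toFun y → x = y) :
    A.Closed {x | f.toFun x = g.toFun x} := by
  intro n F x hx y hy
  have hfg : f.toFun ∘ x = g.toFun ∘ x := funext hx
  have : f.toFun y ∈ g.toFun '' A.fn F x := by
    rw [g.map_fn, ← hfg, ← f.map_fn]
    exact ⟨y, hy, rfl⟩
  obtain ⟨z, -, hz⟩ := this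
  obtain rfl := h _ _ hz.symm
  exact hz.symm

section glue

variable {I : Type w₁} {V : I → Type w₂} {W : Type w₃}

/-- The union of the images of a family of structures. -/
def glue (S : ∀ i, Str L (V i)) (g : ∀ i, V i → W) : Str L W where
  fn F x := {y | ∃ i u v, x = g i ∘ u ∧ y = g i v ∧ v ∈ (S i).fn F u}
  rel R x := ∃ i u, x = g i ∘ u ∧ (S i).rel R u

/-- If the members of a family of structures agree on their intersections, then their union
contains each of them as a substructure. -/
def glueEmb (S : ∀ i, Str L (V i)) (g : ∀ i, V i → W) (hg : ∀ i, (g i).Injective)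
    (hrel : ∀ i j {n : ℕ} (R : L.Relations n) (x : Fin n → V i) (y : Fin n → V j),
      g i ∘ x = g j ∘ y → (S i).rel R x → (S j).rel R y)
    (hfn : ∀ i j {n : ℕ} (F : L.Functions n) (x : Fin n → V i) (y : Fin n → V j),
      g i ∘ x = g j ∘ y → ∀ z ∈ (S i).fn F x, ∃ z' ∈ (S j).fn F y, g j z' = g i z) (i : I) :
    Emb (S i) (glue S g) where
  toFun := g i
  injective := hg i
  map_fn F x := by
    ext y
    constructor
    · rintro ⟨z, hz, rfl⟩
      exact ⟨i, x, z, rfl, rfl, hz⟩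
    · rintro ⟨j, u, z, hu, rfl, hz⟩
      exact hfn j i F u x hu.symm z hz
  map_rel R x := by
    constructor
    · intro h
      exact ⟨i, x, rfl, h⟩
    · rintro ⟨j, u, hu, h⟩
      exact hrel j i R u x hu.symm h

end glue

end Str

/-- A finite structure with a projection to a set `X`. -/
structure StrOver (L : FirstOrder.Language.{u, v}) (X : Type w₁) where
  /-- the vertex set -/
  V : Type w
  finite : Finite V
  /-- the structure -/
  str : Str L V
  /-- the projection -/
  proj : V → X

namespace StrOver

variable {X : Type w₁} {A : Type w} {SA : Str L A}

/-- For each colouring of the copies of `A` in `Z` there is a copy of `Y` in `Z` over the base in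
which the colour of a copy of `A` over a map `α ∈ l` depends only on `α`. -/
def HomogeneousOver (SA : Str L A) (Y Z : StrOver.{u, v, w} L X) (l : Set (A → X)) : Prop :=
  ∀ χ : Emb SA Z.str → Fin 2, ∃ f : Emb Y.str Z.str, (∀ x, Z.proj (f.toFun x) = Y.proj x) ∧
    ∀ α ∈ l, ∀ e e' : Emb SA Y.str, (∀ a, Y.proj (e.toFun a) = α a) →
      (∀ a, Y.proj (e'.toFun a) = α a) → χ (f.comp e) = χ (f.comp e')

theorem homogeneousOver_self {Y : StrOver.{u, v, w} L X} {l : Set (A → X)}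
    (h : ∀ α ∈ l, ∀ e : Emb SA Y.str, ¬ ∀ a, Y.proj (e.toFun a) = α a) :
    HomogeneousOver SA Y Y l :=
  fun _ => ⟨Emb.id _, fun _ => rfl, fun α hα e _ he _ => absurd he (h α hα e)⟩

theorem exists_homogeneousOver {good : StrOver.{u, v, w} L X → Prop} {𝒜 : Set (A → X)}
    (step : ∀ Y, good Y → ∀ α ∈ 𝒜, ∃ Z, good Z ∧ HomogeneousOver SA Y Z {α}) (l : List (A → X))
    (hl : ∀ α ∈ l, α ∈ 𝒜) (Y : StrOver.{u, v, w} L X) (hY : good Y) :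
    ∃ Z, good Z ∧ HomogeneousOver SA Y Z {α | α ∈ l} := by
  induction l generalizing Y with
  | nil => exact ⟨Y, hY, homogeneousOver_self (by simp)⟩
  | cons α l ih =>
    obtain ⟨Y', hY', h⟩ := step Y hY α (hl α (by simp))
    obtain ⟨Z, hZ, h'⟩ := ih (fun β hβ => hl β (by simp [hβ])) Y' hY'
    refine ⟨Z, hZ, fun χ => ?_⟩
    obtain ⟨g, hg, hgl⟩ := h' χ
    obtain ⟨f, hf, hfl⟩ := h fun e => χ (g.comp e)
    refine ⟨g.comp f, fun x => (hg _).trans (hf x), ?_⟩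
    intro β hβ e e' he he'
    rcases List.mem_cons.1 hβ with rfl | hβ
    · exact hfl _ rfl e e' he he'
    · exact hgl β hβ (f.comp e) (f.comp e') (fun a => (hf _).trans (he a))
        (fun a => (hf _).trans (he' a))

/-- The partite lemma for structures with no restrictions. -/
theorem exists_homogeneousOver_singleton [Finite A] (Y : StrOver.{u, v, w} L X) {α : A → X}
    (hα : α.Injective) : ∃ Z, HomogeneousOver SA Y Z {α} := by
  classical
  have := Y.finite
  let σ := {e : Emb SA Y.str // ∀ a, Y.proj (e.toFun a) = α a}
  by_cases hσ : Nonempty σ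
  swap
  · refine ⟨Y, homogeneousOver_self ?_⟩
    rintro _ rfl e he
    exact hσ ⟨⟨e, he⟩⟩
  have hEq : ∀ s t : σ, SA.Closed {a | s.1.toFun a = t.1.toFun a} := by
    refine fun s t => Str.closed_equalizer s.1 t.1 fun a b h => hα ?_
    rw [← s.2, ← t.2, h]
  obtain ⟨W, I, _, _, τ, g, hτ, hg, hram, hPP⟩ := exists_clean_ramsey_system
    (𝒞 := {S | SA.Closed S}) (ε := fun s : σ => s.1.toFun) (fun T hT => Str.closed_sInter hT)
    hEq (π := Y.proj) hα (fun s a => s.2 a)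
  -- Where two copies of `Y` meet, both carry the structure of the same closed part `S` of `A`;
  -- closedness keeps function values inside the intersection.
  let emb := Str.glueEmb (fun _ : I => Y.str) g hg (by
    intro i j n R x y hxy hx
    by_cases hij : i = j
    · subst hij
      rwa [← (hg i).comp_left hxy]
    obtain ⟨s, t, S, hS, h⟩ := hPP i j hij
    choose a ha hx' hy' using fun k => (h (x k) (y k)).1 (congrFun hxy k)
    obtain rfl : x = s.1.toFun ∘ a := funext hx'
    obtain rfl : y = t.1.toFun ∘ a := funext hy'
    exact (t.1.map_rel R a).1 ((s.1.map_rel R a).2 hx)) (by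
    intro i j n F x y hxy z hz
    by_cases hij : i = j
    · subst hij
      obtain rfl := (hg i).comp_left hxy
      exact ⟨z, hz, rfl⟩
    obtain ⟨s, t, S, hS, h⟩ := hPP i j hij
    choose a ha hx' hy' using fun k => (h (x k) (y k)).1 (congrFun hxy k)
    obtain rfl : x = s.1.toFun ∘ a := funext hx'
    obtain rfl : y = t.1.toFun ∘ a := funext hy'
    rw [← s.1.map_fn] at hz
    obtain ⟨b, hb, rfl⟩ := hz
    refine ⟨t.1.toFun b, ?_, ((h _ _).2 ⟨b, hS F a ha hb, rfl, rfl⟩).symm⟩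
    rw [← t.1.map_fn]
    exact ⟨b, hb, rfl⟩)
  refine ⟨⟨W, inferInstance, Str.glue (fun _ : I => Y.str) g, τ⟩, fun χ => ?_⟩
  obtain ⟨i, hi⟩ := hram fun m => if h : ∃ e : Emb SA (Str.glue (fun _ : I => Y.str) g), e.toFun = m then χ h.choose else 0
  refine ⟨emb i, hτ i, ?_⟩
  have key : ∀ s : σ, (if h : ∃ e : Emb SA (Str.glue (fun _ : I => Y.str) g), e.toFun = fun a => g i (s.1.toFun a) then
      χ h.choose else 0) = χ ((emb i).comp s.1) := by
    intro s
    have h : ∃ e : Emb SA (Str.glue (fun _ : I => Y.str) g), e.toFun = fun a => g i (s.1.toFun a) :=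
      ⟨(emb i).comp s.1, rfl⟩
    rw [dif_pos h]
    congr 1
    exact Emb.ext fun a => congrFun h.choose_spec a
  rintro _ rfl e e' he he'
  rw [← key ⟨e, he⟩, ← key ⟨e', he'⟩]
  exact hi _ _

end StrOver

end Structures

/-! ### Free star amalgams and their irreducible substructures. -/

section StarAmalgam

variable {L : FirstOrder.Language.{u, v}}

/-- The substructure with vertex set `E` is not the free amalgam of its intersections with two
closed sets, unless it lies in one of them. -/
def Str.IrreducibleOn {V : Type w₁} (A : Str L V) (E : Set V) : Prop :=
  ∀ S T : Set V, A.Closed S → A.Closed T → E ⊆ S ∪ T →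
    (∀ {n : ℕ} (R : L.Relations n) (x : Fin n → V), (∀ i, x i ∈ E) → A.rel R x →
      (∀ i, x i ∈ S) ∨ (∀ i, x i ∈ T)) →
    (∀ {n : ℕ} (F : L.Functions n) (x : Fin n → V) (y : V), (∀ i, x i ∈ E) → y ∈ A.fn F x →
      ((∀ i, x i ∈ S) ∧ y ∈ S) ∨ ((∀ i, x i ∈ T) ∧ y ∈ T)) →
    E ⊆ S ∨ E ⊆ T

theorem Str.Irreducible.irreducibleOn_range {V : Type w₁} {W : Type w₂} {A : Str L V} {B : Str L W}
    (hA : A.Irreducible) (f : Emb A B) : B.IrreducibleOn (Set.range f.toFun) := by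
  intro S T hS hT hST hR hF
  by_contra! h
  refine hA ⟨f.toFun ⁻¹' S, f.toFun ⁻¹' T, Closed.preimage f hS, Closed.preimage f hT, ?_, ?_,
    ?_⟩
  · rintro h'
    refine h.1 ?_
    rintro _ ⟨x, rfl⟩
    exact h'.symm.subset (Set.mem_univ x)
  · rintro h'
    refine h.2 ?_
    rintro _ ⟨x, rfl⟩
    exact h'.symm.subset (Set.mem_univ x)
  · have h₁ : Set.range (A.subtype (Closed.preimage f hS)).toFun = f.toFun ⁻¹' S :=
      Subtype.range_val
    have h₂ : Set.range (A.subtype (Closed.preimage f hT)).toFun = f.toFun ⁻¹' T :=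
      Subtype.range_val
    constructor
    · rfl
    · rw [h₁, h₂]
      exact (Subtype.range_val (s := f.toFun ⁻¹' S ∩ f.toFun ⁻¹' T)).symm
    · rw [h₁, h₂]
      exact Set.eq_univ_of_forall fun x => hST ⟨x, rfl⟩
    · intro n R x hx
      rw [h₁, h₂]
      exact hR R (f.toFun ∘ x) (fun i => ⟨x i, rfl⟩) ((f.map_rel R x).1 hx)
    · intro n F x y hy
      rw [h₁, h₂]
      refine hF F (f.toFun ∘ x) (f.toFun y) (fun i => ⟨x i, rfl⟩) ?_
      rw [← f.map_fn]
      exact ⟨y, hy, rfl⟩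

variable {U V Λ : Type w} {C : Str L U} {P : Str L V} {Q : Set V}

/-- The vertex sets of the pieces of a star amalgam. -/
abbrev StarPiece (U V : Type w) {Λ : Type w} : Option Λ → Type w
  | none => U
  | some _ => V

/-- The pieces of a star amalgam. -/
def starStr (C : Str L U) (P : Str L V) : ∀ o : Option Λ, Str L (StarPiece U V o)
  | none => C
  | some _ => P

open Classical in
/-- The inclusions of the pieces into the star amalgam. -/
noncomputable def starMap (φ : Λ → Emb (P.induce Q) C) :
    ∀ o : Option Λ, StarPiece U V o → U ⊕ Λ × ↥Qᶜ
  | none, x => Sum.inl x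
  | some l, x => if h : x ∈ Q then Sum.inl ((φ l).toFun ⟨x, h⟩) else Sum.inr (l, ⟨x, h⟩)

theorem starMap_none (φ : Λ → Emb (P.induce Q) C) (x : U) : starMap φ none x = Sum.inl x := rfl

theorem starMap_mem (φ : Λ → Emb (P.induce Q) C) (l : Λ) {x : V} (h : x ∈ Q) :
    starMap φ (some l) x = Sum.inl ((φ l).toFun ⟨x, h⟩) := dif_pos h

theorem starMap_notMem (φ : Λ → Emb (P.induce Q) C) (l : Λ) {x : V} (h : x ∉ Q) :
    starMap φ (some l) x = Sum.inr (l, ⟨x, h⟩) := dif_neg h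

theorem starMap_injective (φ : Λ → Emb (P.induce Q) C) :
    ∀ o, (starMap φ o).Injective
  | none => Sum.inl_injective
  | some l => by
    intro (x : V) (y : V) h
    by_cases hx : x ∈ Q <;> by_cases hy : y ∈ Q
    · rw [starMap_mem φ l hx, starMap_mem φ l hy] at h
      exact congrArg Subtype.val ((φ l).injective (Sum.inl_injective h))
    · rw [starMap_mem φ l hx, starMap_notMem φ l hy] at h
      cases h
    · rw [starMap_notMem φ l hx, starMap_mem φ l hy] at h
      cases h
    · rw [starMap_notMem φ l hx, starMap_notMem φ l hy] at h
      exact congrArg (fun p => (p.2 : V)) (Sum.inr_injective h)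

theorem starMap_eq_inl {φ : Λ → Emb (P.induce Q) C} {l : Λ} {x : V} {y : U}
    (h : starMap φ (some l) x = Sum.inl y) : ∃ hx : x ∈ Q, (φ l).toFun ⟨x, hx⟩ = y := by
  by_cases hx : x ∈ Q
  · rw [starMap_mem φ l hx] at h
    exact ⟨hx, Sum.inl_injective h⟩
  · rw [starMap_notMem φ l hx] at h
    cases h

theorem starMap_eq_starMap {φ : Λ → Emb (P.induce Q) C} {l m : Λ} (hlm : l ≠ m) {x y : V}
    (h : starMap φ (some l) x = starMap φ (some m) y) :
    ∃ (hx : x ∈ Q) (hy : y ∈ Q), (φ l).toFun ⟨x, hx⟩ = (φ m).toFun ⟨y, hy⟩ := by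
  by_cases hy : y ∈ Q
  · rw [starMap_mem φ m hy] at h
    obtain ⟨hx, h⟩ := starMap_eq_inl h
    exact ⟨hx, hy, h⟩
  · rw [starMap_notMem φ m hy] at h
    by_cases hx : x ∈ Q
    · rw [starMap_mem φ l hx] at h
      cases h
    · rw [starMap_notMem φ l hx] at h
      exact absurd (congrArg Prod.fst (Sum.inr_injective h)) hlm

theorem starMap_rel (φ : Λ → Emb (P.induce Q) C) : ∀ (o o' : Option Λ) {n : ℕ}
    (R : L.Relations n) (x : Fin n → StarPiece U V o) (y : Fin n → StarPiece U V o'),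
    starMap φ o ∘ x = starMap φ o' ∘ y → (starStr C P o).rel R x → (starStr C P o').rel R y
  | none, none, _, _, x, y, h, hx => by
    have : x = y := (starMap_injective φ none).comp_left h
    exact this ▸ hx
  | none, some l, _, R, x, y, h, hx => by
    choose hy hy' using fun i => starMap_eq_inl (congrFun h i).symm
    refine ((φ l).map_rel R fun i => ⟨y i, hy i⟩).2 ?_
    have : (φ l).toFun ∘ (fun i => ⟨y i, hy i⟩) = x := funext hy'
    rw [this]
    exact hx
  | some l, none, _, R, x, y, h, hx => by
    choose hy hy' using fun i => starMap_eq_inl (congrFun h i)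
    obtain rfl : (φ l).toFun ∘ (fun i => ⟨x i, hy i⟩) = y := funext hy'
    exact ((φ l).map_rel R fun i => ⟨x i, hy i⟩).1 hx
  | some l, some m, _, R, x, y, h, hx => by
    by_cases hlm : l = m
    · subst hlm
      have : x = y := (starMap_injective φ (some l)).comp_left h
      exact this ▸ hx
    choose hx' hy' h' using fun i => starMap_eq_starMap hlm (congrFun h i)
    have := ((φ l).map_rel R fun i => ⟨x i, hx' i⟩).1 hx
    rw [show (φ l).toFun ∘ (fun i => ⟨x i, hx' i⟩) = (φ m).toFun ∘ (fun i => ⟨y i, hy' i⟩) from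
      funext h'] at this
    exact ((φ m).map_rel R fun i => ⟨y i, hy' i⟩).2 this

/-- Different pieces share only arguments from `Q` or its images; as `Q` is closed, the values there
are shared too. -/
theorem starMap_fn (hQ : P.Closed Q) (φ : Λ → Emb (P.induce Q) C) : ∀ (o o' : Option Λ) {n : ℕ}
    (F : L.Functions n) (x : Fin n → StarPiece U V o) (y : Fin n → StarPiece U V o'),
    starMap φ o ∘ x = starMap φ o' ∘ y → ∀ z ∈ (starStr C P o).fn F x,
      ∃ z' ∈ (starStr C P o').fn F y, starMap φ o' z' = starMap φ o z
  | none, none, _, _, x, y, h, z, hz => by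
    have : x = y := (starMap_injective φ none).comp_left h
    exact ⟨z, this ▸ hz, rfl⟩
  | none, some l, _, F, x, y, h, z, hz => by
    choose hy hy' using fun i => starMap_eq_inl (congrFun h i).symm
    obtain rfl : (φ l).toFun ∘ (fun i => ⟨y i, hy i⟩) = x := funext hy'
    have hz' : z ∈ C.fn F ((φ l).toFun ∘ (fun i => ⟨y i, hy i⟩)) := hz
    rw [← (φ l).map_fn] at hz'
    obtain ⟨⟨z', hz'Q⟩, hz', rfl⟩ := hz'
    exact ⟨z', hz', starMap_mem φ l hz'Q⟩
  | some l, none, _, F, x, y, h, z, hz => by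
    choose hy hy' using fun i => starMap_eq_inl (congrFun h i)
    obtain rfl : (φ l).toFun ∘ (fun i => ⟨x i, hy i⟩) = y := funext hy'
    have hzQ : z ∈ Q := hQ F x hy hz
    refine ⟨(φ l).toFun ⟨z, hzQ⟩, ?_, (starMap_mem φ l hzQ).symm⟩
    change _ ∈ C.fn F ((φ l).toFun ∘ (fun i => ⟨x i, hy i⟩))
    rw [← (φ l).map_fn]
    exact ⟨⟨z, hzQ⟩, hz, rfl⟩
  | some l, some m, _, F, x, y, h, z, hz => by
    by_cases hlm : l = m
    · subst hlm
      have : x = y := (starMap_injective φ (some l)).comp_left h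
      exact ⟨z, this ▸ hz, rfl⟩
    choose hx' hy' h' using fun i => starMap_eq_starMap hlm (congrFun h i)
    have hzQ : z ∈ Q := hQ F x hx' hz
    have : (φ l).toFun ⟨z, hzQ⟩ ∈ C.fn F ((φ l).toFun ∘ (fun i => ⟨x i, hx' i⟩)) := by
      rw [← (φ l).map_fn]
      exact ⟨⟨z, hzQ⟩, hz, rfl⟩
    rw [show (φ l).toFun ∘ (fun i => ⟨x i, hx' i⟩) = (φ m).toFun ∘ (fun i => ⟨y i, hy' i⟩) from
      funext h', ← (φ m).map_fn] at this
    obtain ⟨⟨z', hz'Q⟩, hz', h''⟩ := this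
    refine ⟨z', hz', ?_⟩
    rw [starMap_mem φ m hz'Q, starMap_mem φ l hzQ, h'']

/-- The free amalgam of a structure `C` and copies of `P` whose substructures `Q` are glued to
`C`. -/
theorem exists_star_amalgam [Finite U] [Finite V] [Finite Λ] (hQ : P.Closed Q)
    (φ : Λ → Emb (P.induce Q) C) {X : Type w₁} (πC : U → X) (πP : Λ → V → X)
    (hπ : ∀ l (x : Q), πC ((φ l).toFun x) = πP l x) :
    ∃ (Y : StrOver.{u, v, w} L X) (j : Emb C Y.str) (f : Λ → Emb P Y.str),
      (∀ x, Y.proj (j.toFun x) = πC x) ∧ (∀ l x, Y.proj ((f l).toFun x) = πP l x) ∧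
      (∀ l (x : Q), (f l).toFun x = j.toFun ((φ l).toFun x)) ∧
      ∀ E, Y.str.IrreducibleOn E →
        E ⊆ Set.range j.toFun ∨ ∃ l, E ⊆ Set.range (f l).toFun := by
  let emb := Str.glueEmb (starStr C P) (starMap φ) (starMap_injective φ) (starMap_rel φ)
    (starMap_fn hQ φ)
  refine ⟨⟨U ⊕ Λ × ↥Qᶜ, inferInstance, Str.glue (starStr C P) (starMap φ),
    Sum.elim πC fun p => πP p.1 p.2⟩, emb none, fun l => emb (some l), fun x => rfl,
    fun l x => ?_, fun l x => starMap_mem φ l x.2, fun E hE => ?_⟩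
  · by_cases hx : x ∈ Q
    · exact (congrArg _ (starMap_mem φ l hx)).trans (hπ l ⟨x, hx⟩)
    · exact (congrArg _ (starMap_notMem φ l hx))
  · by_contra! h
    -- The copy `l` and the complement of its new vertices are closed and split every tuple freely.
    -- An irreducible `E` not inside the copy therefore avoids all its new vertices.
    have hT : ∀ l, E ⊆ {w | ∀ x ∉ Q, w ≠ starMap φ (some l) x} := by
      intro l
      have hpiece : ∀ o, o ≠ some l → ∀ x, ∀ y ∉ Q, starMap φ o x ≠ starMap φ (some l) y := by
        rintro (_ | m) hm x y hy hxy
        · exact hy (starMap_eq_inl (hxy.symm.trans (starMap_none φ x))).1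
        · exact hy (starMap_eq_starMap (fun h => hm (by rw [h])) hxy).2.1
      refine (hE (Set.range (emb (some l)).toFun) _ (Str.closed_range _) ?_ ?_ ?_ ?_).resolve_left
        (h.2 l)
      · rintro n F x hx y ⟨o, x', y', rfl, rfl, hy⟩
        by_cases ho : o = some l
        · subst ho
          intro z hz hyz
          have hx' : ∀ i, x' i ∈ Q := fun i => by
            by_contra hi
            exact hx i _ hi rfl
          have : y' ∈ Q := hQ F x' hx' hy
          exact hz (starMap_injective φ (some l) hyz ▸ this)
        · exact hpiece o ho y'
      · intro w _
        by_cases hw : ∃ x, starMap φ (some l) x = w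
        · exact Or.inl hw
        · exact Or.inr fun x _ hx => hw ⟨x, hx.symm⟩
      · rintro n R _ - ⟨o, x', rfl, -⟩
        by_cases ho : o = some l
        · subst ho
          exact Or.inl fun i => ⟨x' i, rfl⟩
        · exact Or.inr fun i => hpiece o ho _
      · rintro n F _ _ - ⟨o, x', y', rfl, rfl, -⟩
        by_cases ho : o = some l
        · subst ho
          exact Or.inl ⟨fun i => ⟨x' i, rfl⟩, y', rfl⟩
        · exact Or.inr ⟨fun i => hpiece o ho _, hpiece o ho _⟩
    refine h.1 ?_
    rintro (x | ⟨l, x, hx⟩) hw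
    · exact ⟨x, rfl⟩
    · exact absurd (starMap_notMem φ l hx).symm (hT l hw x hx)

/-- Copies of `B` glued over a closed set `K`. -/
theorem exists_glued_copies {V I : Type w} [Finite V] [Finite I] [Nonempty I] (B : Str L V)
    {K : Set V} (hK : B.Closed K) {X : Type w₁} (β : I → V → X)
    (hβ : ∀ i j, ∀ x ∈ K, β i x = β j x) :
    ∃ (Y : StrOver.{u, v, w} L X) (f : I → Emb B Y.str),
      (∀ i x, Y.proj ((f i).toFun x) = β i x) ∧
      ∀ E, Y.str.IrreducibleOn E → ∃ i, E ⊆ Set.range (f i).toFun := by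
  obtain ⟨i₀⟩ := ‹Nonempty I›
  obtain ⟨Y, j, f, -, hf, hfj, hE⟩ := exists_star_amalgam hK
    (fun _ : I => Emb.id (B.induce K)) (fun x => β i₀ x) β (fun i x => hβ i₀ i x x.2)
  refine ⟨Y, f, hf, fun E h => (hE E h).elim (fun h => ⟨i₀, fun x hx => ?_⟩) _root_.id⟩
  obtain ⟨y, rfl⟩ := h hx
  exact ⟨y, hfj i₀ y⟩

end StarAmalgam

/-- The finite Ramsey theorem for two colours. -/
theorem exists_ramsey_number (k : ℕ) : ∀ m : ℕ, ∃ N : ℕ, ∀ S : Finset ℕ, N ≤ S.card →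
    ∀ c : Finset ℕ → Fin 2, ∃ H ⊆ S, H.card = m ∧
      ∀ s ⊆ H, ∀ t ⊆ H, s.card = k → t.card = k → c s = c t := by
  induction k with
  | zero =>
    refine fun m => ⟨m, fun S hS c => ?_⟩
    obtain ⟨H, hH, hHm⟩ := Finset.exists_subset_card_eq hS
    refine ⟨H, hH, hHm, fun s _ t _ hs ht => ?_⟩
    rw [Finset.card_eq_zero.1 hs, Finset.card_eq_zero.1 ht]
  | succ k ih =>
    -- On `H` the colour of a `(k + 1)`-set depends only on its least element.
    have endHom : ∀ m : ℕ, ∃ N : ℕ, ∀ S : Finset ℕ, N ≤ S.card → ∀ c : Finset ℕ → Fin 2,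
        ∃ H ⊆ S, H.card = m ∧ ∃ d : ℕ → Fin 2, ∀ x ∈ H, ∀ s ⊆ H, s.card = k →
          (∀ y ∈ s, x < y) → c (insert x s) = d x := by
      intro m
      induction m with
      | zero =>
        exact ⟨0, fun S _ c => ⟨∅, by simp, rfl, fun _ => 0, by simp⟩⟩
      | succ m ihm =>
        obtain ⟨N₁, hN₁⟩ := ihm
        obtain ⟨N, hN⟩ := ih N₁
        refine ⟨N + 1, fun S hS c => ?_⟩
        have hne : S.Nonempty := Finset.card_pos.1 (by omega)
        set x := S.min' hne with hx
        have hxS : x ∈ S := S.min'_mem hne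
        obtain ⟨H₁, hH₁S, hH₁, hc⟩ := hN (S.erase x) (by rw [Finset.card_erase_of_mem hxS]; omega)
          fun s => c (insert x s)
        obtain ⟨H, hHH, hHm, d, hd⟩ := hN₁ H₁ hH₁.ge c
        have hlt : ∀ y ∈ H, x < y := by
          intro y hy
          have := hH₁S (hHH hy)
          exact lt_of_le_of_ne (S.min'_le y (Finset.mem_of_mem_erase this))
            (Finset.ne_of_mem_erase this).symm
        have hxH : x ∉ H := fun h => lt_irrefl x (hlt x h)
        have hsub : ∀ s ⊆ insert x H, x ∉ s → s ⊆ H := by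
          intro s hs hxs y hy
          rcases Finset.mem_insert.1 (hs hy) with rfl | h
          · exact absurd hy hxs
          · exact h
        classical
        refine ⟨insert x H, ?_, by rw [Finset.card_insert_of_notMem hxH, hHm],
          fun y => if y = x then
            (if h : ∃ s ⊆ H, s.card = k then c (insert x h.choose) else 0) else d y, ?_⟩
        · intro y hy
          rcases Finset.mem_insert.1 hy with rfl | h
          · exact hxS
          · exact Finset.mem_of_mem_erase (hH₁S (hHH h))
        · intro y hy s hs hsk hys
          have hxs : x ∉ s := by
            intro h
            have h1 := hys x h
            rcases Finset.mem_insert.1 hy with rfl | h2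
            · exact lt_irrefl _ h1
            · exact lt_asymm h1 (hlt y h2)
          have hsH := hsub s hs hxs
          rcases Finset.mem_insert.1 hy with rfl | h
          · have hex : ∃ s ⊆ H, s.card = k := ⟨s, hsH, hsk⟩
            simp only [if_true, dif_pos hex]
            exact hc s (hsH.trans hHH) _ (hex.choose_spec.1.trans hHH) hsk hex.choose_spec.2
          · simp only [if_neg (hlt y h).ne']
            exact hd y h s hsH hsk hys
    intro m
    -- By pigeonhole, `m` of the `2 * m` elements have the same value under `d`.
    obtain ⟨N, hN⟩ := endHom (2 * m)
    refine ⟨N, fun S hS c => ?_⟩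
    obtain ⟨H, hHS, hH, d, hd⟩ := hN S hS c
    obtain ⟨i, -, hi⟩ := Finset.exists_le_card_fiber_of_mul_le_card_of_maps_to
      (s := H) (t := Finset.univ) (f := d) (n := m) (fun _ _ => Finset.mem_univ _)
      Finset.univ_nonempty (by simp [hH])
    obtain ⟨H', hH', hH'm⟩ := Finset.exists_subset_card_eq hi
    refine ⟨H', hH'.trans ((Finset.filter_subset _ _).trans hHS), hH'm, ?_⟩
    have key : ∀ s ⊆ H', s.card = k + 1 → c s = i := by
      intro s hs hsk
      have hne : s.Nonempty := Finset.card_pos.1 (by omega)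
      have hmem := s.min'_mem hne
      have hf : ∀ y ∈ s, y ∈ H ∧ d y = i := fun y hy => by simpa using hH' (hs hy)
      rw [← Finset.insert_erase hmem, ← (hf _ hmem).2]
      refine hd _ (hf _ hmem).1 _ (fun y hy => (hf y (Finset.mem_of_mem_erase hy)).1)
        (by rw [Finset.card_erase_of_mem hmem]; omega) fun y hy => ?_
      exact lt_of_le_of_ne (s.min'_le y (Finset.mem_of_mem_erase hy))
        (Finset.ne_of_mem_erase hy).symm
    intro s hs t ht hsk htk
    rw [key s hs hsk, key t ht htk]

/-! ### Adding the order, and the partite construction in general form. -/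

section Order

variable {L : FirstOrder.Language.{u, v}} {lt : L.Relations 2}

namespace Str

variable {V : Type w₁} {W : Type w₂}

/-- The expansion of a structure without `lt` by a relation `r`, which becomes the
interpretation of `lt`. -/
def withRel (S : Str (eraseRel L lt) V) (r : V → V → Prop) : Str L V where
  fn {n} F x := S.fn (n := n) F x
  rel {n} R x := (∃ h : (⟨n, R⟩ : Σ m, L.Relations m) ≠ ⟨2, lt⟩,
      S.rel (⟨R, h⟩ : (eraseRel L lt).Relations n) x) ∨
    ∃ a b, r a b ∧ (⟨n, R, x⟩ : Σ m, L.Relations m × (Fin m → V)) = ⟨2, lt, ![a, b]⟩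

theorem withRel_lt (S : Str (eraseRel L lt) V) (r : V → V → Prop) (a b : V) :
    (S.withRel r).rel lt ![a, b] ↔ r a b := by
  constructor
  · rintro (⟨h, -⟩ | ⟨a', b', h, h'⟩)
    · exact absurd rfl h
    · have h' : ![a, b] = ![a', b'] := by simpa using h'
      have h0 := congrFun h' 0
      have h1 := congrFun h' 1
      simp only [Matrix.cons_val_zero, Matrix.cons_val_one] at h0 h1
      rwa [h0, h1]
  · exact fun h => Or.inr ⟨a, b, h, rfl⟩

theorem withRel_rel (S : Str (eraseRel L lt) V) (r : V → V → Prop) {n : ℕ} (R : L.Relations n)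
    (h : (⟨n, R⟩ : Σ m, L.Relations m) ≠ ⟨2, lt⟩) (x : Fin n → V) :
    (S.withRel r).rel R x ↔ S.rel (⟨R, h⟩ : (eraseRel L lt).Relations n) x := by
  constructor
  · rintro (⟨_, h⟩ | ⟨a, b, -, h'⟩)
    · exact h
    · exact absurd (congrArg (fun p => (⟨p.1, p.2.1⟩ : Σ m, L.Relations m)) h') h
  · exact fun h' => Or.inl ⟨h, h'⟩

end Str

namespace Emb

variable {V : Type w₁} {W : Type w₂} {A : Str L V} {B : Str L W}

/-- An embedding as an embedding of reducts. -/
def reduct (lt : L.Relations 2) (f : Emb A B) : Emb (A.reduct lt) (B.reduct lt) where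
  toFun := f.toFun
  injective := f.injective
  map_fn {n} F x := f.map_fn (n := n) F x
  map_rel R x := f.map_rel R.1 x

/-- An injective map that respects the functions, the order and the other relations. -/
def ofReduct (lt : L.Relations 2) (f : V → W) (hf : f.Injective)
    (hfn : ∀ {n : ℕ} (F : L.Functions n) (x : Fin n → V), f '' A.fn F x = B.fn F (f ∘ x))
    (hrel : ∀ {n : ℕ} (R : L.Relations n), (⟨n, R⟩ : Σ m, L.Relations m) ≠ ⟨2, lt⟩ →
      ∀ x : Fin n → V, A.rel R x ↔ B.rel R (f ∘ x))
    (hlt : ∀ a b, A.rel lt ![a, b] ↔ B.rel lt ![f a, f b]) : Emb A B where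
  toFun := f
  injective := hf
  map_fn := hfn
  map_rel {n} R x := by
    by_cases h : (⟨n, R⟩ : Σ m, L.Relations m) = ⟨2, lt⟩
    · cases h
      have h₁ : x = ![x 0, x 1] := by ext i; fin_cases i <;> rfl
      have h₂ : f ∘ x = ![f (x 0), f (x 1)] := by ext i; fin_cases i <;> rfl
      rw [h₂, ← hlt, ← h₁]
    · exact hrel R h x

/-- An embedding of the reduct that respects the order. -/
def toWithRel {S : Str (eraseRel L lt) W} {r : W → W → Prop} (f : Emb (A.reduct lt) S)
    (hlt : ∀ a b, A.rel lt ![a, b] ↔ r (f.toFun a) (f.toFun b)) : Emb A (S.withRel r) :=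
  ofReduct lt f.toFun f.injective (fun {n} F x => f.map_fn (n := n) F x)
    (fun {n} R h x => (f.map_rel (⟨R, h⟩ : (eraseRel L lt).Relations n) x).trans
      (Str.withRel_rel S r R h _).symm)
    (fun a b => (hlt a b).trans (Str.withRel_lt S r _ _).symm)

/-- An embedding into an expansion as an embedding of the reduct. -/
def ofWithRel {S : Str (eraseRel L lt) W} {r : W → W → Prop} (f : Emb A (S.withRel r)) :
    Emb (A.reduct lt) S where
  toFun := f.toFun
  injective := f.injective
  map_fn {n} F x := f.map_fn (n := n) F x
  map_rel R x := (f.map_rel R.1 x).trans (Str.withRel_rel S r R.1 R.2 _)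

theorem lt_iff {f : Emb A B} (a b : V) : A.rel lt ![a, b] ↔ B.rel lt ![f.toFun a, f.toFun b] := by
  rw [f.map_rel]
  have : f.toFun ∘ ![a, b] = ![f.toFun a, f.toFun b] := by ext i; fin_cases i <;> rfl
  rw [this]

end Emb

/-- A strict linear order of the vertices for which the projection is monotone. -/
def StrOver.order {X : Type w₁} (r : X → X → Prop) (Y : StrOver.{u, v, w} L X) (x y : Y.V) : Prop :=
  r (Y.proj x) (Y.proj y) ∨ Y.proj x = Y.proj y ∧ WellOrderingRel x y

theorem StrOver.isStrictTotalOrder_order {X : Type w₁} (r : X → X → Prop) [IsStrictTotalOrder X r]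
    (Y : StrOver.{u, v, w} L X) : IsStrictTotalOrder Y.V (Y.order r) where
  trichotomous x y h₁ h₂ := by
    simp only [order, not_or, not_and] at h₁ h₂
    have h := Std.Trichotomous.trichotomous (r := r) _ _ h₁.1 h₂.1
    exact Std.Trichotomous.trichotomous (r := WellOrderingRel) _ _ (h₁.2 h) (h₂.2 h.symm)
  irrefl x h := by
    rcases h with h | ⟨-, h⟩
    · exact irrefl_of r _ h
    · exact irrefl_of WellOrderingRel _ h
  trans x y z := by
    rintro (h | ⟨h, h'⟩) (k | ⟨k, k'⟩)
    · exact Or.inl (trans_of r h k)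
    · exact Or.inl (k ▸ h)
    · exact Or.inl (h ▸ k)
    · exact Or.inr ⟨h.trans k, trans_of WellOrderingRel h' k'⟩

theorem Str.Ordered.withRel_order {X : Type w₁} (r : X → X → Prop) [IsStrictTotalOrder X r]
    (Y : StrOver.{u, v, w} (eraseRel L lt) X) : (Y.str.withRel (Y.order r)).Ordered lt := by
  have := Y.isStrictTotalOrder_order r
  unfold Str.Ordered
  simp only [Str.withRel_lt]
  exact this

/-- A strictly monotone map reflects the order. -/
theorem rel_iff_of_rel_imp {V : Type w₁} {X : Type w₂} (s : V → V → Prop) (r : X → X → Prop)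
    [IsStrictTotalOrder V s] [IsStrictTotalOrder X r] {f : V → X}
    (hf : ∀ x y, s x y → r (f x) (f y)) (x y : V) : s x y ↔ r (f x) (f y) := by
  refine ⟨hf x y, fun h => ?_⟩
  by_contra h'
  by_cases h'' : s y x
  · exact irrefl_of r _ (trans_of r h (hf _ _ h''))
  · obtain rfl := Std.Trichotomous.trichotomous (r := s) _ _ h' h''
    exact irrefl_of r _ h

theorem injective_of_rel_imp {V : Type w₁} {X : Type w₂} (s : V → V → Prop) (r : X → X → Prop)
    [IsStrictTotalOrder V s] [IsStrictTotalOrder X r] {f : V → X}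
    (hf : ∀ x y, s x y → r (f x) (f y)) : f.Injective := by
  intro x y h
  refine Std.Trichotomous.trichotomous (r := s) _ _ (fun h' => ?_) (fun h' => ?_)
  · exact irrefl_of r _ (h ▸ hf _ _ h')
  · exact irrefl_of r _ (h ▸ hf _ _ h')

/-- The partite lemma enters as `step`, with `good` as its invariant. The construction concerns
reducts only: a copy of `B` over a strictly monotone `β i` automatically respects an order that
compares projections first. -/
theorem exists_arrow_of_partite {A B I : Type w} [Finite A] [Finite B] [Finite I] {SA : Str L A}
    {SB : Str L B} (hB : SB.Ordered lt) {X : Type w₁} (r : X → X → Prop)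
    [IsStrictTotalOrder X r] {β : I → B → X}
    (hβ : ∀ i x y, SB.rel lt ![x, y] → r (β i x) (β i y))
    {good : StrOver.{u, v, w} (eraseRel L lt) X → Prop}
    (step : ∀ Y, good Y → ∀ i (e : Emb SA SB),
      ∃ Z, good Z ∧ StrOver.HomogeneousOver (SA.reduct lt) Y Z {fun a => β i (e.toFun a)})
    {Y : StrOver.{u, v, w} (eraseRel L lt) X} (hY : good Y) (f : I → Emb (SB.reduct lt) Y.str)
    (hf : ∀ i x, Y.proj ((f i).toFun x) = β i x)
    (hram : ∀ c : (A → X) → Fin 2, ∃ i, ∀ e e' : Emb SA SB,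
      c (fun a => β i (e.toFun a)) = c (fun a => β i (e'.toFun a))) :
    ∃ Z : StrOver.{u, v, w} (eraseRel L lt) X, good Z ∧
      Arrow (Z.str.withRel (Z.order r)) SB SA 2 := by
  classical
  have : IsStrictTotalOrder B fun x y => SB.rel lt ![x, y] := hB
  have : Fintype (I × Emb SA SB) := Fintype.ofFinite _
  obtain ⟨Z, hZ, hom⟩ := StrOver.exists_homogeneousOver (SA := SA.reduct lt)
    (𝒜 := {α | ∃ p : I × Emb SA SB, α = fun a => β p.1 (p.2.toFun a)})
    (by rintro Y hY _ ⟨p, rfl⟩; exact step Y hY p.1 p.2)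
    ((Finset.univ : Finset (I × Emb SA SB)).toList.map fun p a => β p.1 (p.2.toFun a))
    (by
      intro α hα
      obtain ⟨p, -, rfl⟩ := List.mem_map.1 hα
      exact ⟨p, rfl⟩) Y hY
  refine ⟨Z, hZ, fun χ => ?_⟩
  -- Embeddings of reducts that violate the order get the dummy colour `0`; those inside the final
  -- copy of `B` respect it.
  let χ' : Emb (SA.reduct lt) Z.str → Fin 2 := fun e' =>
    if h : ∃ e : Emb SA (Z.str.withRel (Z.order r)), e.toFun = e'.toFun then χ h.choose else 0
  obtain ⟨g, hg, hgl⟩ := hom χ'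
  let c : (A → X) → Fin 2 := fun α =>
    if h : ∃ p : I × Emb SA SB, (fun a => β p.1 (p.2.toFun a)) = α then
      χ' (g.comp ((f h.choose.1).comp (h.choose.2.reduct lt))) else 0
  have hc : ∀ i (e : Emb SA SB), c (fun a => β i (e.toFun a)) =
      χ' (g.comp ((f i).comp (e.reduct lt))) := by
    intro i e
    have h : ∃ p : I × Emb SA SB,
        (fun a => β p.1 (p.2.toFun a)) = fun a => β i (e.toFun a) := ⟨(i, e), rfl⟩
    simp only [c, dif_pos h]
    refine hgl (fun a => β i (e.toFun a)) ?_ _ _ ?_ ?_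
    · exact List.mem_map.2 ⟨(i, e), by simp, rfl⟩
    · exact fun a => (hf _ _).trans (congrFun h.choose_spec a)
    · exact fun a => hf _ _
  obtain ⟨i, hi⟩ := hram c
  have hproj : ∀ b, Z.proj (g.toFun ((f i).toFun b)) = β i b := fun b => (hg _).trans (hf i b)
  let G : Emb SB (Z.str.withRel (Z.order r)) := (g.comp (f i)).toWithRel (fun a b => by
    have := Z.isStrictTotalOrder_order r
    refine rel_iff_of_rel_imp (fun x y => SB.rel lt ![x, y]) (Z.order r)
      (fun x y hxy => Or.inl ?_) a b
    change r (Z.proj (g.toFun ((f i).toFun x))) (Z.proj (g.toFun ((f i).toFun y)))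
    rw [hproj, hproj]
    exact hβ i x y hxy)
  have hG : ∀ e : Emb SA SB, χ' (g.comp ((f i).comp (e.reduct lt))) = χ (G.comp e) := by
    intro e
    have h : ∃ e' : Emb SA (Z.str.withRel (Z.order r)),
        e'.toFun = (g.comp ((f i).comp (e.reduct lt))).toFun := ⟨G.comp e, rfl⟩
    simp only [χ', dif_pos h]
    congr 1
    exact Emb.ext (congrFun h.choose_spec)
  refine ⟨G, fun e e' => ?_⟩
  rw [← hG, ← hG, ← hc, ← hc]
  exact hi e e'

end Order

/-! ### The Ramsey property of all finite ordered structures. -/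

section Unrestricted

/-- Strictly monotone maps on a finite set are determined by their images. -/
theorem eq_of_image_eq {V : Type w₁} {X : Type w₂} [Finite V] (s : V → V → Prop) (r : X → X → Prop)
    [IsStrictTotalOrder V s] [IsStrictTotalOrder X r] {f g : V → X}
    (hf : ∀ x y, s x y → r (f x) (f y)) (hg : ∀ x y, s x y → r (g x) (g y)) {S : Set V}
    (h : f '' S = g '' S) {x : V} (hx : x ∈ S) : f x = g x := by
  classical
  let _ : LinearOrder V := linearOrderOfSTO s
  let _ : LinearOrder X := linearOrderOfSTO r
  have hf' : StrictMono fun y : S => f y := fun a b hab => hf a b hab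
  have hg' : StrictMono fun y : S => g y := fun a b hab => hg a b hab
  rw [Set.image_eq_range, Set.image_eq_range] at h
  exact congrFun ((hf'.range_inj hg').1 h) ⟨x, hx⟩

theorem exists_monotone_range_eq {V : Type w₁} [Finite V] (s : V → V → Prop)
    [IsStrictTotalOrder V s] (H : Finset ℕ) (hH : H.card = Nat.card V) :
    ∃ f : V → ℕ, (∀ x y, s x y → f x < f y) ∧ Set.range f = H := by
  classical
  let _ : LinearOrder V := linearOrderOfSTO s
  have : Fintype V := Fintype.ofFinite V
  let φ : Fin (Nat.card V) ≃o V := Fintype.orderIsoFinOfCardEq V Nat.card_eq_fintype_card.symm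
  refine ⟨fun x => H.orderEmbOfFin hH (φ.symm x), fun x y hxy => ?_, ?_⟩
  · exact (H.orderEmbOfFin hH).strictMono (φ.symm.strictMono hxy)
  · rw [← H.range_orderEmbOfFin hH]
    exact φ.symm.surjective.range_comp _

variable {L : FirstOrder.Language.{u, v}} {lt : L.Relations 2}

open Classical in
/-- The position of a vertex in the order: first with respect to the closure of the empty set, and
then with respect to a map to the natural numbers. -/
noncomputable def position {V : Type w₁} (S : Str L V) (lt : L.Relations 2) (f : V → ℕ) (x : V) :
    ℕ ×ₗ ℕ :=
  toLex ({z ∈ S.cl ∅ | S.rel lt ![z, x] ∨ z = x}.ncard, if x ∈ S.cl ∅ then 0 else f x + 1)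

/-- Embeddings carry the closure of the empty set onto that of the target, so positions can be
computed inside `A`. Hence the map of a copy of `A` to the base depends only on `f ∘ e`, which the
finite Ramsey theorem controls. -/
theorem position_comp {V : Type w₁} {W : Type w₂} {A : Str L V} {B : Str L W} (e : Emb A B)
    (f : W → ℕ) (x : V) : position B lt f (e.toFun x) = position A lt (f ∘ e.toFun) x := by
  have : {z ∈ B.cl ∅ | B.rel lt ![z, e.toFun x] ∨ z = e.toFun x} =
      e.toFun '' {z ∈ A.cl ∅ | A.rel lt ![z, x] ∨ z = x} := by
    ext y
    constructor
    · rintro ⟨hy, h⟩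
      rw [Str.cl_empty_eq_image e] at hy
      obtain ⟨z, hz, rfl⟩ := hy
      rw [← Emb.lt_iff, e.injective.eq_iff] at h
      exact ⟨z, ⟨hz, h⟩, rfl⟩
    · rintro ⟨z, ⟨hz, h⟩, rfl⟩
      refine ⟨(Str.mem_cl_empty_iff e z).2 hz, ?_⟩
      rwa [← Emb.lt_iff, e.injective.eq_iff]
  unfold position
  rw [this, Set.ncard_image_of_injective _ e.injective]
  by_cases hx : x ∈ A.cl ∅
  · rw [if_pos hx, if_pos ((Str.mem_cl_empty_iff e x).2 hx)]
  · rw [if_neg hx, if_neg (mt (Str.mem_cl_empty_iff e x).1 hx)]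
    rfl

/-- The first coordinate never decreases, and it grows when `y` lies in the closure of the empty
set. In a tie the shift `f y + 1` puts `y` above vertices of that closure, whose second coordinate
is `0`. -/
theorem position_lt {V : Type w₁} [Finite V] {S : Str L V} (hS : S.Ordered lt) {f : V → ℕ}
    (hf : ∀ x y, S.rel lt ![x, y] → f x < f y) (x y : V) (hxy : S.rel lt ![x, y]) :
    position S lt f x < position S lt f y := by
  have : IsStrictTotalOrder V fun x y => S.rel lt ![x, y] := hS
  have hsub : {z ∈ S.cl ∅ | S.rel lt ![z, x] ∨ z = x} ⊆ {z ∈ S.cl ∅ | S.rel lt ![z, y] ∨ z = y} := by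
    rintro z ⟨hz, h | rfl⟩
    · exact ⟨hz, Or.inl (trans_of (fun x y => S.rel lt ![x, y]) h hxy)⟩
    · exact ⟨hz, Or.inl hxy⟩
  unfold position
  rw [Prod.Lex.toLex_lt_toLex]
  by_cases hy : y ∈ S.cl ∅
  · left
    refine Set.ncard_lt_ncard (Set.ssubset_iff_of_subset hsub |>.2 ⟨y, ⟨hy, Or.inr rfl⟩, ?_⟩)
      (Set.toFinite _)
    rintro ⟨-, h | rfl⟩
    · exact asymm_of (fun x y => S.rel lt ![x, y]) h hxy
    · exact irrefl_of (fun x y => S.rel lt ![x, y]) _ hxy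
  · rcases (Set.ncard_le_ncard hsub (Set.toFinite _)).lt_or_eq with h | h
    · exact Or.inl h
    · refine Or.inr ⟨h, ?_⟩
      simp only [if_neg hy]
      split_ifs
      · omega
      · exact Nat.succ_lt_succ (hf x y hxy)

/-- The class of all finite ordered structures is Ramsey. -/
theorem exists_ordered_arrow {A B : Type w} [Finite A] [Finite B] {SA : Str L A} {SB : Str L B}
    (hA : SA.Ordered lt) (hB : SB.Ordered lt) :
    ∃ C : FinStr.{u, v, w} L, C.str.Ordered lt ∧ Arrow C.str SB SA 2 := by
  classical
  have : IsStrictTotalOrder A fun x y => SA.rel lt ![x, y] := hA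
  have : IsStrictTotalOrder B fun x y => SB.rel lt ![x, y] := hB
  obtain ⟨N, hN⟩ := exists_ramsey_number (Nat.card A) (Nat.card B)
  let I := {f : B → Fin N // ∀ x y, SB.rel lt ![x, y] → f x < f y}
  let β : I → B → ℕ ×ₗ ℕ := fun i => position SB lt fun x => i.1 x
  have hβ : ∀ i x y, SB.rel lt ![x, y] → β i x < β i y := fun i x y =>
    position_lt hB (fun x y h => i.2 x y h) x y
  have hram : ∀ c : (A → ℕ ×ₗ ℕ) → Fin 2, ∃ i, ∀ e e' : Emb SA SB,
      c (fun a => β i (e.toFun a)) = c (fun a => β i (e'.toFun a)) := by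
    intro c
    -- A set of the size of `A` is the range of a unique monotone map from `A`, and inherits the
    -- colour of its positions.
    let c' : Finset ℕ → Fin 2 := fun s =>
      if h : ∃ f : A → ℕ, (∀ x y, SA.rel lt ![x, y] → f x < f y) ∧ Set.range f = s then
        c (position SA lt h.choose) else 0
    have hc' : ∀ f : A → ℕ, (∀ x y, SA.rel lt ![x, y] → f x < f y) → ∀ s : Finset ℕ,
        Set.range f = s → c' s = c (position SA lt f) := by
      intro f hf s hs
      have h : ∃ f : A → ℕ, (∀ x y, SA.rel lt ![x, y] → f x < f y) ∧ Set.range f = s :=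
        ⟨f, hf, hs⟩
      have heq : h.choose = f := by
        funext x
        refine eq_of_image_eq (fun x y => SA.rel lt ![x, y]) (· < ·) h.choose_spec.1 hf
          (S := Set.univ) ?_ (Set.mem_univ x)
        rw [Set.image_univ, Set.image_univ, h.choose_spec.2, hs]
      simp only [c', dif_pos h, heq]
    obtain ⟨H, hHN, hH, hmono⟩ := hN (Finset.range N) (by simp) c'
    obtain ⟨f, hf, hfH⟩ := exists_monotone_range_eq (fun x y => SB.rel lt ![x, y]) H hH
    have hfN : ∀ x, f x < N := fun x => Finset.mem_range.1 (hHN (by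
      rw [← Finset.mem_coe, ← hfH]
      exact ⟨x, rfl⟩))
    refine ⟨⟨fun x => ⟨f x, hfN x⟩, fun x y h => hf x y h⟩, ?_⟩
    have key : ∀ e : Emb SA SB, ∃ s ⊆ H, s.card = Nat.card A ∧
        c (fun a => position SB lt f (e.toFun a)) = c' s := by
      intro e
      have : Fintype A := Fintype.ofFinite A
      have hmon : ∀ x y, SA.rel lt ![x, y] → (f ∘ e.toFun) x < (f ∘ e.toFun) y :=
        fun x y h => hf _ _ ((Emb.lt_iff x y).1 h)
      refine ⟨Finset.univ.image (f ∘ e.toFun), ?_, ?_, ?_⟩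
      · intro y hy
        obtain ⟨a, -, rfl⟩ := Finset.mem_image.1 hy
        rw [← Finset.mem_coe, ← hfH]
        exact ⟨_, rfl⟩
      · rw [Finset.card_image_of_injective _ (injective_of_rel_imp
          (fun x y => SA.rel lt ![x, y]) (· < ·) hmon), Finset.card_univ, Nat.card_eq_fintype_card]
      · rw [hc' _ hmon _ (by rw [Finset.coe_image, Finset.coe_univ, Set.image_univ])]
        congr 1
        funext a
        exact position_comp e f a
    intro e e'
    obtain ⟨s, hs, hsA, h⟩ := key e
    obtain ⟨t, ht, htA, h'⟩ := key e'
    exact h.trans ((hmono s hs t ht hsA htA).trans h'.symm)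
  obtain ⟨i₀, -⟩ := hram fun _ => 0
  have : Nonempty I := ⟨i₀⟩
  -- Nullary functions force the copies to share the closure of the empty set; this is possible
  -- because positions there do not depend on `i`.
  obtain ⟨Y, f, hf, -⟩ := exists_glued_copies (SB.reduct lt) (K := SB.cl ∅)
    (fun {n} F x => Str.closed_cl (A := SB) ∅ (n := n) F x) β (fun i j x hx => by
      simp only [β, position, if_pos hx])
  obtain ⟨Z, -, hZ⟩ := exists_arrow_of_partite (good := fun _ => True) hB (· < ·) hβ (SA := SA)
    (fun Y _ i e => by
      obtain ⟨Z, hZ⟩ := StrOver.exists_homogeneousOver_singleton (SA := SA.reduct lt) Y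
        (α := fun a => β i (e.toFun a)) ((injective_of_rel_imp (fun x y => SB.rel lt ![x, y])
          (· < ·) (hβ i)).comp e.injective)
      exact ⟨Z, trivial, hZ⟩) (Y := Y) trivial f hf hram
  exact ⟨⟨Z.V, Z.finite, _⟩, Str.Ordered.withRel_order _ Z, hZ⟩

end Unrestricted

/-! ### The partite lemma over a structure, controlling irreducible substructures. -/

section Restricted

variable {L : FirstOrder.Language.{u, v}}

/-- The map `π` restricts to an embedding of the substructure with vertex set `E`. -/
structure EmbedsOn {V : Type w₁} {X : Type w₂} (S : Str L V) (D : Str L X) (π : V → X)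
    (E : Set V) : Prop where
  injOn : Set.InjOn π E
  rel_iff : ∀ {n : ℕ} (R : L.Relations n) (x : Fin n → V), (∀ i, x i ∈ E) →
    (S.rel R x ↔ D.rel R (π ∘ x))
  image_fn : ∀ {n : ℕ} (F : L.Functions n) (x : Fin n → V), (∀ i, x i ∈ E) →
    π '' S.fn F x = D.fn F (π ∘ x)

namespace Str

variable {V : Type w₁} {W : Type w₂} {A : Str L V} {B : Str L W}

theorem irreducibleOn_cl_of_rel {n : ℕ} {R : L.Relations n} {x : Fin n → V} (h : A.rel R x) :
    A.IrreducibleOn (A.cl (Set.range x)) := by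
  intro S T hS hT _ hR _
  refine (hR R x (fun i => subset_cl _ ⟨i, rfl⟩) h).imp (fun h => cl_subset hS ?_)
    (fun h => cl_subset hT ?_) <;>
  · rintro _ ⟨i, rfl⟩
    exact h i

theorem irreducibleOn_cl_of_mem_fn {n : ℕ} {F : L.Functions n} {x : Fin n → V} {y : V}
    (h : y ∈ A.fn F x) : A.IrreducibleOn (A.cl (Set.range x)) := by
  intro S T hS hT _ _ hF
  refine (hF F x y (fun i => subset_cl _ ⟨i, rfl⟩) h).imp (fun h => cl_subset hS ?_)
    (fun h => cl_subset hT ?_) <;>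
  · rintro _ ⟨i, rfl⟩
    exact h.1 i

theorem IrreducibleOn.preimage {E : Set W} (hE : B.IrreducibleOn E) (f : Emb A B)
    (hEf : E ⊆ Set.range f.toFun) : A.IrreducibleOn (f.toFun ⁻¹' E) := by
  intro S T hS hT hST hR hF
  have key : ∀ {n : ℕ} (x : Fin n → W), (∀ i, x i ∈ E) →
      ∃ u, x = f.toFun ∘ u ∧ ∀ i, u i ∈ f.toFun ⁻¹' E := by
    intro n x hx
    choose u hu using fun i => hEf (hx i)
    obtain rfl : f.toFun ∘ u = x := funext hu
    exact ⟨u, rfl, hx⟩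
  have h := hE (f.toFun '' S) (f.toFun '' T) (Closed.image f hS) (Closed.image f hT) ?_ ?_ ?_
  · refine h.imp (fun h x hx => ?_) (fun h x hx => ?_) <;>
    · obtain ⟨y, hy, hyx⟩ := h hx
      rwa [← f.injective hyx]
  · intro x hx
    obtain ⟨y, rfl⟩ := hEf hx
    exact (hST hx).imp (fun h => ⟨y, h, rfl⟩) (fun h => ⟨y, h, rfl⟩)
  · intro n R x hx h
    obtain ⟨u, rfl, hu⟩ := key x hx
    exact (hR R u hu ((f.map_rel R u).2 h)).imp (fun h i => ⟨u i, h i, rfl⟩)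
      (fun h i => ⟨u i, h i, rfl⟩)
  · intro n F x y hx h
    obtain ⟨u, rfl, hu⟩ := key x hx
    rw [← f.map_fn] at h
    obtain ⟨z, hz, rfl⟩ := h
    exact (hF F u z hu hz).imp (fun h => ⟨fun i => ⟨u i, h.1 i, rfl⟩, z, h.2, rfl⟩)
      (fun h => ⟨fun i => ⟨u i, h.1 i, rfl⟩, z, h.2, rfl⟩)

end Str

theorem EmbedsOn.of_preimage {V : Type w₁} {W : Type w₂} {X : Type w₃} {S : Str L V} {T : Str L W}
    {D : Str L X} {πS : V → X} {πT : W → X} {E : Set W} (f : Emb S T)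
    (hf : ∀ x, πT (f.toFun x) = πS x) (hE : E ⊆ Set.range f.toFun)
    (h : EmbedsOn S D πS (f.toFun ⁻¹' E)) : EmbedsOn T D πT E := by
  have hf' : ∀ {n : ℕ} (u : Fin n → V), πT ∘ f.toFun ∘ u = πS ∘ u := fun u =>
    funext fun i => hf (u i)
  have key : ∀ {n : ℕ} (x : Fin n → W), (∀ i, x i ∈ E) →
      ∃ u, x = f.toFun ∘ u ∧ ∀ i, u i ∈ f.toFun ⁻¹' E := by
    intro n x hx
    choose u hu using fun i => hE (hx i)
    obtain rfl : f.toFun ∘ u = x := funext hu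
    exact ⟨u, rfl, hx⟩
  refine ⟨fun x hx y hy hxy => ?_, fun R x hx => ?_, fun F x hx => ?_⟩
  · obtain ⟨x, rfl⟩ := hE hx
    obtain ⟨y, rfl⟩ := hE hy
    rw [hf, hf] at hxy
    rw [h.injOn hx hy hxy]
  · obtain ⟨u, rfl, hu⟩ := key x hx
    rw [← f.map_rel, hf', h.rel_iff R u hu]
  · obtain ⟨u, rfl, hu⟩ := key x hx
    rw [← f.map_fn, hf', ← h.image_fn F u hu, Set.image_image]
    simp only [hf]

namespace StrOver

variable {X : Type w₁} {D : Str L X} {𝒢 : Set (Set X)}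

/-- The projection embeds each irreducible substructure, and maps it to a part of a member
of `𝒢`. -/
def Good (D : Str L X) (𝒢 : Set (Set X)) (Y : StrOver.{u, v, w} L X) : Prop :=
  ∀ E, Y.str.Closed E → Y.str.IrreducibleOn E →
    EmbedsOn Y.str D Y.proj E ∧ ∃ G ∈ 𝒢, Y.proj '' E ⊆ G

namespace Good

variable {Y : StrOver.{u, v, w} L X}

theorem rel (hY : Y.Good D 𝒢) {n : ℕ} {R : L.Relations n} {x : Fin n → Y.V} (h : Y.str.rel R x) :
    D.rel R (Y.proj ∘ x) :=
  ((hY _ (Str.closed_cl _) (Str.irreducibleOn_cl_of_rel h)).1.rel_iff R x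
    fun i => Str.subset_cl _ ⟨i, rfl⟩).1 h

/-- The witness `y` makes the closure of `x` irreducible. Without a witness nothing is known: a
value may be empty in `Y` and nonempty in `D`. -/
theorem proj_mem_fn (hY : Y.Good D 𝒢) {n : ℕ} {F : L.Functions n} {x : Fin n → Y.V} {y : Y.V}
    (h : y ∈ Y.str.fn F x) : Y.proj y ∈ D.fn F (Y.proj ∘ x) := by
  rw [← (hY _ (Str.closed_cl _) (Str.irreducibleOn_cl_of_mem_fn h)).1.image_fn F x
    fun i => Str.subset_cl _ ⟨i, rfl⟩]
  exact ⟨y, h, rfl⟩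

theorem injOn_fn (hY : Y.Good D 𝒢) {n : ℕ} (F : L.Functions n) (x : Fin n → Y.V) :
    Set.InjOn Y.proj (Y.str.fn F x) := by
  intro y hy z hz hyz
  have hsub := Str.closed_cl (A := Y.str) (Set.range x) F x fun i => Str.subset_cl _ ⟨i, rfl⟩
  exact (hY _ (Str.closed_cl _) (Str.irreducibleOn_cl_of_mem_fn hy)).1.injOn (hsub hy) (hsub hz) hyz

end Good

/-- The structure of the words all of whose letters lie over the same vertex in the range
of `α`. -/
def wordStr {A : Type w₂} (Y : StrOver.{u, v, w} L X) (α : A → X) (ι : Type) :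
    Str L {u : ι → Y.V // ∃ a, ∀ j, Y.proj (u j) = α a} where
  fn F x := {y | ∀ j, y.1 j ∈ Y.str.fn F fun i => (x i).1 j}
  rel R x := ∀ j, Y.str.rel R fun i => (x i).1 j

/-- A splitting of the `j`-th letters pulls back to words, so the letters of an irreducible set
generate an irreducible substructure of `Y`, which the projection embeds. All letters of a word
project alike, so a relation holds in all coordinates or in none, and function values can be
assembled letter by letter. -/
theorem Good.wordStr {A : Type w₂} {SA : Str L A} {Y : StrOver.{u, v, w} L X}
    (hY : Y.Good D 𝒢) (α : Emb SA D) {ι : Type} (j₀ : ι)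
    {E : Set {u : ι → Y.V // ∃ a, ∀ j, Y.proj (u j) = α.toFun a}}
    (hE : (Y.wordStr α.toFun ι).IrreducibleOn E) :
    EmbedsOn (Y.wordStr α.toFun ι) D (fun u => Y.proj (u.1 j₀)) E := by
  have hproj : ∀ (u : {u : ι → Y.V // ∃ a, ∀ j, Y.proj (u j) = α.toFun a}) j,
      Y.proj (u.1 j) = Y.proj (u.1 j₀) := by
    rintro ⟨u, a, ha⟩ j
    exact (ha j).trans (ha j₀).symm
  have key : ∀ j, EmbedsOn Y.str D Y.proj (Y.str.cl ((fun u => u.1 j) '' E)) := by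
    intro j
    have hmem : ∀ u ∈ E, u.1 j ∈ Y.str.cl ((fun u => u.1 j) '' E) := fun u hu =>
      Str.subset_cl _ ⟨u, hu, rfl⟩
    refine (hY _ (Str.closed_cl _) fun S T hS hT hST hR hF => ?_).1
    have := hE {u | u.1 j ∈ S} {u | u.1 j ∈ T} (fun F x hx y hy => hS F _ hx (hy j))
      (fun F x hx y hy => hT F _ hx (hy j)) (fun u hu => hST (hmem u hu))
      (fun R x hx h => hR R _ (fun i => hmem _ (hx i)) (h j))
      (fun F x y hx h => hF F _ _ (fun i => hmem _ (hx i)) (h j))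
    refine this.imp (fun h => Str.cl_subset hS ?_) (fun h => Str.cl_subset hT ?_) <;>
    · rintro _ ⟨u, hu, rfl⟩
      exact h hu
  have hcomp : ∀ {n : ℕ} (x : Fin n → {u : ι → Y.V // ∃ a, ∀ j, Y.proj (u j) = α.toFun a}) j,
      (Y.proj ∘ fun i => (x i).1 j) = (fun u => Y.proj (u.1 j₀)) ∘ x := fun x j =>
    funext fun i => hproj (x i) j
  have hmem : ∀ {n : ℕ} (x : Fin n → {u : ι → Y.V // ∃ a, ∀ j, Y.proj (u j) = α.toFun a}) j,
      (∀ i, x i ∈ E) → ∀ i, (x i).1 j ∈ Y.str.cl ((fun u => u.1 j) '' E) := fun x j hx i =>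
    Str.subset_cl _ ⟨x i, hx i, rfl⟩
  refine ⟨fun x hx y hy hxy => ?_, fun R x hx => ?_, fun F x hx => ?_⟩
  · refine Subtype.ext (funext fun j => ?_)
    refine (key j).injOn (Str.subset_cl _ ⟨x, hx, rfl⟩) (Str.subset_cl _ ⟨y, hy, rfl⟩) ?_
    rw [hproj x j, hproj y j]
    exact hxy
  · have : ∀ j, Y.str.rel R (fun i => (x i).1 j) ↔ D.rel R ((fun u => Y.proj (u.1 j₀)) ∘ x) :=
      fun j => by rw [(key j).rel_iff R _ (hmem x j hx), hcomp]
    exact ⟨fun h => (this j₀).1 (h j₀), fun h j => (this j).2 h⟩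
  · apply Set.Subset.antisymm
    · rintro _ ⟨y, hy, rfl⟩
      rw [← hcomp x j₀, ← (key j₀).image_fn F _ (hmem x j₀ hx)]
      exact ⟨_, hy j₀, rfl⟩
    · intro z hz
      have hz' : ∀ j, ∃ y ∈ Y.str.fn F fun i => (x i).1 j, Y.proj y = z := by
        intro j
        rw [← hcomp x j, ← (key j).image_fn F _ (hmem x j hx)] at hz
        exact hz
      obtain ⟨a, rfl⟩ : z ∈ Set.range α.toFun := by
        refine Str.closed_range α F _ (fun i => ?_) hz
        obtain ⟨a, ha⟩ := (x i).2
        exact ⟨a, (ha j₀).symm⟩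
      choose y hy hyz using hz'
      exact ⟨⟨y, a, hyz⟩, hy, hyz j₀⟩

/-- The vertices of `Y` over `α` are mapped to words by a combinatorial line of copies of `A`. -/
noncomputable def wordEmb {A : Type w} {SA : Str L A} {Y : StrOver.{u, v, w} L X}
    (hY : Y.Good D 𝒢) (α : Emb SA D) {ι : Type}
    (l : Combinatorics.Line {e : Emb SA Y.str // ∀ a, Y.proj (e.toFun a) = α.toFun a} ι) :
    Emb (Y.str.induce (Y.proj ⁻¹' Set.range α.toFun)) (Y.wordStr α.toFun ι) where
  toFun x := ⟨lineWord Y.proj α.toFun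
    (fun e : {e : Emb SA Y.str // ∀ a, Y.proj (e.toFun a) = α.toFun a} => e.1.toFun) l x, x.2.choose, fun j =>
    (map_redirect (E := fun e : {e : Emb SA Y.str // ∀ a, Y.proj (e.toFun a) = α.toFun a} =>
      e.1.toFun) (fun e => e.2) (l.idxFun j) x.1).trans x.2.choose_spec.symm⟩
  injective x y h := Subtype.ext (lineWord_injective l (Subtype.ext_iff.1 h))
  -- A fixed coordinate is the projection followed by a copy of `A`, which preserves tuples; a
  -- moving coordinate is the identity, which also reflects them.
  map_fn {n} F x := by
    choose a ha using fun i => (x i).2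
    have ha' : α.toFun ∘ a = Y.proj ∘ fun i => (x i).1 := funext ha
    have hfix : ∀ {j c}, l.idxFun j = some c → (fun i => lineWord Y.proj α.toFun
        (fun e : {e : Emb SA Y.str // ∀ a, Y.proj (e.toFun a) = α.toFun a} => e.1.toFun) l
        (x i) j) = c.1.toFun ∘ a := by
      intro j c h
      funext i
      simp only [lineWord, h]
      exact redirect_some α.injective c (ha i).symm
    have hmov : ∀ {j}, l.idxFun j = none → (fun i => lineWord Y.proj α.toFun
        (fun e : {e : Emb SA Y.str // ∀ a, Y.proj (e.toFun a) = α.toFun a} => e.1.toFun) l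
        (x i) j) = fun i => (x i).1 := by
      intro j h
      funext i
      simp only [lineWord, h, redirect_none]
    ext y
    constructor
    · rintro ⟨⟨z, hzQ⟩, hz, rfl⟩ j
      have hz : z ∈ Y.str.fn F fun i => (x i).1 := hz
      change lineWord _ _ _ l z j ∈ Y.str.fn F (fun i => lineWord _ _ _ l (x i) j)
      cases h : l.idxFun j with
      | none =>
        rw [hmov h]
        simpa only [lineWord, h, redirect_none] using hz
      | some c =>
        rw [hfix h, ← c.1.map_fn]
        have hzD := hY.proj_mem_fn hz
        rw [← ha', ← α.map_fn] at hzD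
        obtain ⟨b, hb, hbz⟩ := hzD
        refine ⟨b, hb, ?_⟩
        simp only [lineWord, h]
        exact (redirect_some (E := fun e : {e : Emb SA Y.str // ∀ a, Y.proj (e.toFun a) = α.toFun a} =>
          e.1.toFun) α.injective c hbz.symm).symm
    · intro hy
      have hy : ∀ j, y.1 j ∈ Y.str.fn F (fun i => lineWord Y.proj α.toFun
        (fun e : {e : Emb SA Y.str // ∀ a, Y.proj (e.toFun a) = α.toFun a} => e.1.toFun) l
        (x i) j) := hy
      obtain ⟨k, hk⟩ := l.proper
      obtain ⟨b, hb⟩ := y.2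
      have hyk := hy k
      rw [hmov hk] at hyk
      -- The preimage is read off at the moving coordinate `k`. Other moving letters agree with it
      -- by `injOn_fn`, and fixed ones because their copy of `A` lies over `α`.
      refine ⟨⟨y.1 k, b, (hb k).symm⟩, hyk, Subtype.ext (funext fun j => ?_)⟩
      have hyj := hy j
      change lineWord _ _ _ l (y.1 k) j = y.1 j
      cases h : l.idxFun j with
      | none =>
        rw [hmov h] at hyj
        simp only [lineWord, h, redirect_none]
        exact hY.injOn_fn F _ hyk hyj ((hb k).trans (hb j).symm)
      | some c =>
        rw [hfix h, ← c.1.map_fn] at hyj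
        obtain ⟨d, hd, hdy⟩ := hyj
        have : d = b := α.injective (by rw [← c.2, hdy, hb])
        subst this
        simp only [lineWord, h]
        rw [redirect_some α.injective c (hb k), hdy]
  map_rel {n} R x := by
    choose a ha using fun i => (x i).2
    have ha' : α.toFun ∘ a = Y.proj ∘ fun i => (x i).1 := funext ha
    constructor
    · intro h j
      have h : Y.str.rel R fun i => (x i).1 := h
      change Y.str.rel R (fun i => lineWord _ _ _ l (x i) j)
      cases hj : l.idxFun j with
      | none => simpa only [lineWord, hj, redirect_none] using h
      | some c =>
        have hD := hY.rel h
        rw [← ha', ← α.map_rel, c.1.map_rel] at hD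
        convert hD using 2 with i
        simp only [lineWord, hj]
        exact redirect_some α.injective c (ha i).symm
    · intro h
      obtain ⟨k, hk⟩ := l.proper
      have h : Y.str.rel R (fun i => lineWord Y.proj α.toFun
        (fun e : {e : Emb SA Y.str // ∀ a, Y.proj (e.toFun a) = α.toFun a} => e.1.toFun) l
        (x i) k) := h k
      simp only [lineWord, hk, redirect_none] at h
      exact h

/-- The partite lemma that keeps irreducible substructures under control. -/
theorem Good.exists_homogeneousOver_singleton {A : Type w} [Finite A] {SA : Str L A}
    {Y : StrOver.{u, v, w} L X} (hY : Y.Good D 𝒢) (α : Emb SA D) (hα : Set.range α.toFun ∈ 𝒢) :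
    ∃ Z : StrOver.{u, v, w} L X, Z.Good D 𝒢 ∧ HomogeneousOver SA Y Z {α.toFun} := by
  classical
  have := Y.finite
  let κ := {e : Emb SA Y.str // ∀ a, Y.proj (e.toFun a) = α.toFun a}
  obtain ⟨ι, _, hι⟩ := Combinatorics.Line.exists_mono_in_high_dimension κ (Fin 2)
  obtain ⟨l₀, -⟩ := hι fun _ => 0
  have ⟨j₀, _⟩ := l₀.proper
  have : Finite (Combinatorics.Line κ ι) :=
    Finite.of_injective (fun l => l.idxFun) fun l m h => Combinatorics.Line.ext h
  have hQ : Y.str.Closed (Y.proj ⁻¹' Set.range α.toFun) := fun F x hx y hy =>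
    Str.closed_range α F _ hx (hY.proj_mem_fn hy)
  obtain ⟨Z, j, f, hj, hf, hfj, hirr⟩ := exists_star_amalgam hQ
    (fun l : Combinatorics.Line κ ι => wordEmb hY α l) (fun u => Y.proj (u.1 j₀))
    (fun _ => Y.proj) (fun l x => map_redirect (fun e => e.2) (l.idxFun j₀) x.1)
  refine ⟨Z, fun E hE hEirr => ?_, fun χ => ?_⟩
  · obtain h | ⟨l, h⟩ := hirr E hEirr
    · refine ⟨(hY.wordStr α j₀ (hEirr.preimage j h)).of_preimage j hj h, _, hα, ?_⟩
      rintro _ ⟨x, hx, rfl⟩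
      obtain ⟨u, rfl⟩ := h hx
      obtain ⟨a, ha⟩ := u.2
      exact ⟨a, (ha j₀).symm.trans (hj u).symm⟩
    · obtain ⟨h₁, G, hG, h₂⟩ := hY _ (Str.Closed.preimage (f l) hE) (hEirr.preimage (f l) h)
      refine ⟨h₁.of_preimage (f l) (hf l) h, G, hG, ?_⟩
      rintro _ ⟨x, hx, rfl⟩
      obtain ⟨y, rfl⟩ := h hx
      exact h₂ ⟨y, hx, (hf l y).symm⟩
  · let word : (ι → κ) → A → {u : ι → Y.V // ∃ a, ∀ j, Y.proj (u j) = α.toFun a} := fun w a =>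
      ⟨fun i => (w i).1.toFun a, a, fun i => (w i).2 a⟩
    obtain ⟨l, c, hl⟩ := hι fun w => if h : ∃ e : Emb SA Z.str,
      (∀ a, e.toFun a = j.toFun (word w a)) then χ h.choose else 0
    have key : ∀ e : κ, χ ((f l).comp e.1) = c := by
      intro e
      have hword : ∀ a, ((f l).comp e.1).toFun a = j.toFun (word (l e) a) := by
        intro a
        refine (hfj l ⟨e.1.toFun a, a, (e.2 a).symm⟩).trans (congrArg _ (Subtype.ext ?_))
        exact lineWord_apply (E := fun e : κ => e.1.toFun) α.injective (fun e => e.2) l e a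
      have h : ∃ e' : Emb SA Z.str, ∀ a, e'.toFun a = j.toFun (word (l e) a) := ⟨_, hword⟩
      have hle := hl e
      simp only [dif_pos h] at hle
      rw [← hle]
      congr 1
      exact Emb.ext fun a => (hword a).trans (h.choose_spec a).symm
    refine ⟨f l, hf l, ?_⟩
    rintro _ rfl e e' he he'
    exact (key ⟨e, he⟩).trans (key ⟨e', he'⟩).symm

end StrOver

end Restricted

/-! ### Transfer to the class of `𝓕`-free structures. -/

section FreeClasses

variable {L : FirstOrder.Language.{u, v}} {lt : L.Relations 2}

/-- Where the arguments agree, `f` and `g` map the value set onto the same set, and both are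
monotone, so they agree on it pointwise. Hence all copies of `B` in `D` coincide on the closure of
the empty set. -/
theorem Str.closed_equalizer_of_ordered {V : Type w₁} {W : Type w₂} [Finite V] {A : Str L V}
    {B : Str L W} (hA : A.Ordered lt) (hB : B.Ordered lt) (f g : Emb A B) :
    A.Closed {x | f.toFun x = g.toFun x} := by
  have : IsStrictTotalOrder V fun x y => A.rel lt ![x, y] := hA
  have : IsStrictTotalOrder W fun x y => B.rel lt ![x, y] := hB
  intro n F x hx y hy
  have hfg : f.toFun ∘ x = g.toFun ∘ x := funext hx
  refine eq_of_image_eq (fun x y => A.rel lt ![x, y]) (fun x y => B.rel lt ![x, y])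
    (fun a b => (Emb.lt_iff a b).1) (fun a b => (Emb.lt_iff a b).1) (S := A.fn F x) ?_ hy
  rw [f.map_fn, g.map_fn, hfg]

theorem Emb.embedsOn {V : Type w₁} {W : Type w₂} {A : Str L V} {B : Str L W} (f : Emb A B)
    (E : Set V) : EmbedsOn A B f.toFun E :=
  ⟨f.injective.injOn, fun R x _ => f.map_rel R x, fun F x _ => f.map_fn F x⟩

/-- An embedding whose range lies in the range of another one factors through it. -/
theorem Emb.nonempty_of_range_subset {U : Type w₁} {V : Type w₂} {W : Type w₃} {A : Str L U}
    {B : Str L V} {C : Str L W} (f : Emb A C) (g : Emb B C)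
    (h : Set.range f.toFun ⊆ Set.range g.toFun) : Nonempty (Emb A B) := by
  choose k hk using fun x => h ⟨x, rfl⟩
  have hk' : ∀ {n : ℕ} (x : Fin n → U), g.toFun ∘ k ∘ x = f.toFun ∘ x := fun x =>
    funext fun i => hk (x i)
  refine ⟨⟨k, fun x y hxy => f.injective ?_, fun F x => g.injective.image_injective ?_,
    fun R x => ?_⟩⟩
  · rw [← hk, ← hk, hxy]
  · rw [g.map_fn, hk', ← f.map_fn, Set.image_image]
    simp only [hk]
  · rw [f.map_rel, g.map_rel, hk']

/-- A structure over an ordered base with good projection contains no structure with irreducible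
reduct that does not embed in one of the parts of the base. -/
theorem StrOver.Good.exists_emb {X : Type w₁} {D : Str L X} (hD : D.Ordered lt)
    {𝒢 : Set (Set X)} {Z : StrOver.{u, v, w} (eraseRel L lt) X} (hZ : Z.Good (D.reduct lt) 𝒢)
    {V : Type w₂} {F : Str L V} (hF : (F.reduct lt).Irreducible)
    (g : Emb F (Z.str.withRel (Z.order fun x y => D.rel lt ![x, y]))) :
    ∃ f : Emb F D, ∃ G ∈ 𝒢, Set.range f.toFun ⊆ G := by
  have : IsStrictTotalOrder X fun x y => D.rel lt ![x, y] := hD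
  let g' := g.ofWithRel
  obtain ⟨hE, G, hG, hsub⟩ := hZ (Set.range g'.toFun) (Str.closed_range g')
    (hF.irreducibleOn_range g')
  have hinj : (Z.proj ∘ g.toFun).Injective := fun x y h =>
    g.injective (hE.injOn ⟨x, rfl⟩ ⟨y, rfl⟩ h)
  refine ⟨Emb.ofReduct lt (Z.proj ∘ g.toFun) hinj (fun {n} F x => ?_) (fun {n} R h x => ?_)
    (fun a b => ?_), G, hG, ?_⟩
  · rw [Set.image_comp, g.map_fn]
    exact hE.image_fn (n := n) F (g.toFun ∘ x) fun i => ⟨x i, rfl⟩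
  · rw [g.map_rel, Str.withRel_rel _ _ R h]
    exact hE.rel_iff (⟨R, h⟩ : (eraseRel L lt).Relations n) (g.toFun ∘ x) fun i => ⟨x i, rfl⟩
  · rw [Emb.lt_iff (f := g), Str.withRel_lt]
    refine ⟨?_, Or.inl⟩
    -- Ties in the projection cannot occur inside an irreducible copy, so the arbitrary tie-breaking
    -- order is harmless.
    rintro (h | ⟨h, h'⟩)
    · exact h
    · obtain rfl := hinj h
      exact absurd h' (irrefl_of WellOrderingRel _)
  · rintro _ ⟨x, rfl⟩
    exact hsub ⟨_, ⟨x, rfl⟩, rfl⟩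

end FreeClasses

end SetValued

theorem mainTheorem3 (L : FirstOrder.Language.{u, v}) (lt : L.Relations 2)
    (𝓕 : Set (SetValued.FinStr.{u, v, w} L))
    (h𝓕 : ∀ F ∈ 𝓕, (F.str.reduct lt).Irreducible) :
    SetValued.IsRamsey (SetValued.orderedFreeClass lt 𝓕) := by
  open SetValued in
  rintro A ⟨hA, hA𝓕⟩ B ⟨hB, hB𝓕⟩
  have := A.finite
  have := B.finite
  obtain ⟨D, hD, hDAB⟩ := exists_ordered_arrow hA hB
  have := D.finite
  have : IsStrictTotalOrder D.carrier fun x y => D.str.rel lt ![x, y] := hD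
  obtain ⟨i₀, -⟩ := hDAB fun _ => 0
  have : Nonempty (Emb B.str D.str) := ⟨i₀⟩
  -- The initial glued copies project into ranges of `B`; the powers added by the partite lemma
  -- project into ranges of `A`.
  let 𝒢 : Set (Set D.carrier) :=
    {G | (∃ f : Emb A.str D.str, G = Set.range f.toFun) ∨
      ∃ f : Emb B.str D.str, G = Set.range f.toFun}
  obtain ⟨Y, f, hf, hirr⟩ := exists_glued_copies (B.str.reduct lt) (K := B.str.cl ∅)
    (fun {n} F x => Str.closed_cl (A := B.str) ∅ (n := n) F x)
    (fun i : Emb B.str D.str => i.toFun) (fun i j x hx =>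
      Str.cl_subset (Str.closed_equalizer_of_ordered hB hD i j) (Set.empty_subset _) hx)
  have hY : Y.Good (D.str.reduct lt) 𝒢 := by
    intro E _ hE
    obtain ⟨i, hi⟩ := hirr E hE
    refine ⟨((i.reduct lt).embedsOn _).of_preimage (f i) (hf i) hi, _, Or.inr ⟨i, rfl⟩, ?_⟩
    rintro _ ⟨x, hx, rfl⟩
    obtain ⟨b, rfl⟩ := hi hx
    exact ⟨b, (hf i b).symm⟩
  obtain ⟨Z, hZ, hZAB⟩ := exists_arrow_of_partite (good := StrOver.Good (D.str.reduct lt) 𝒢)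
    (SA := A.str) hB (fun x y => D.str.rel lt ![x, y]) (β := fun i : Emb B.str D.str => i.toFun)
    (fun i x y => (Emb.lt_iff x y).1)
    (fun Y hY i e => hY.exists_homogeneousOver_singleton ((i.comp e).reduct lt)
      (Or.inl ⟨i.comp e, rfl⟩)) hY f hf (fun c => hDAB fun g => c g.toFun)
  refine ⟨⟨Z.V, Z.finite, _⟩, ⟨Str.Ordered.withRel_order _ Z, fun F hF => ⟨fun g => ?_⟩⟩, hZAB⟩
  obtain ⟨h, G, ⟨k, rfl⟩ | ⟨k, rfl⟩, hG⟩ := hZ.exists_emb hD (h𝓕 F hF) g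
  · exact (h.nonempty_of_range_subset k hG).elim (hA𝓕 F hF).false
  · exact (h.nonempty_of_range_subset k hG).elim (hB𝓕 F hF).false
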